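/- Let $k$ be a field, let $X\subseteq\mathbb P^n_k$ be a projective variety (an integral closed subscheme) and let $\mathcal O_X(1)$ be the restriction of $\mathcal O(1)$. Let $R$ be the homogeneous coordinate ring of $X$, with irrelevant ideal $\mathfrak m=(x_0,\dots,x_n)$. Let $E$ be a vector bundle (locally free sheaf of finite rank) on $X$ and put $M=\Gamma_*(E)=\bigoplus_{d\in\mathbb Z}H^0(X,E(d))$, a graded $R$-module. Let $f\in\operatorname{End}_{\mathcal O_X}(E)$, and let $\lambda_1,\dots,\lambda_r\in k$ be distinct eigenvalues of $f$, that is, $\det(f-\lambda_i\,\mathrm{id}_E)=0$. Let $\mu_i$ be the module-theoretic multiplicity of $\lambda_i$ for $\Gamma_*(f)$: the algebraic multiplicity of $\lambda_i$ as an eigenvalue of the $k$-linear map $A\colon M/\mathfrak mM\to M/\mathfrak mM$ induced by $\Gamma_*(f)$, i.e. the dimension of the generalized eigenspace of $A$ for $\lambda_i$ (which is $0$ if $\lambda_i$ is not an eigenvalue of $A$). Set $$g_i=(f-\lambda_i\,\mathrm{id}_E)^{\mu_i}\quad(1\le i\le r),\qquad g=g_1\circ\cdots\circ g_r .$$ Then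 the inclusions induce a direct sum decomposition $$E=\ker g_1\oplus\cdots\oplus\ker g_r\oplus\operatorname{im} g .$$ Moreover $$\Gamma_*(E)=\ker\Gamma_*(g_1)\oplus\cdots\oplus\ker\Gamma_*(g_r)\oplus\operatorname{im}\Gamma_*(g),$$ and the decomposition of $E$ is obtained from this one by sheafification: $\ker g_i$ and $\operatorname{im} g$ are the subsheaves of $E$ associated to the graded submodules $\ker\Gamma_*(g_i)$ and $\operatorname{im}\Gamma_*(g)$ of $\Gamma_*(E)$. -/

import Mathlib

open CategoryTheory AlgebraicGeometry Limits

universe u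

noncomputable section

namespace BundleDecomposition

/-! ### Projective space and its homogeneous coordinates -/

/-- The standard grading of `k[x_0, …, x_n]` by total degree. -/
abbrev coordGrading (k : Type u) [Field k] (n : ℕ) :
    ℕ → Submodule k (MvPolynomial (Fin (n + 1)) k) :=
  MvPolynomial.homogeneousSubmodule (Fin (n + 1)) k

instance (k : Type u) [Field k] (n : ℕ) : GradedAlgebra (coordGrading k n) :=
  MvPolynomial.gradedAlgebra

/-- Projective space `ℙⁿ` over `k`, that is, `Proj k[x_0, …, x_n]`. -/
abbrev projSpace (k : Type u) [Field k] (n : ℕ) : Scheme.{u} := Proj (coordGrading k n)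

theorem X_mem (k : Type u) [Field k] (n : ℕ) (i : Fin (n + 1)) :
    (MvPolynomial.X i : MvPolynomial (Fin (n + 1)) k) ∈ coordGrading k n 1 :=
  (MvPolynomial.mem_homogeneousSubmodule _ _).2 (MvPolynomial.isHomogeneous_X k i)

/-- The constants `k → Γ(ℙⁿ, 𝒪)` coming from the structure morphism `ℙⁿ ⟶ Spec k[x_0, …, x_n]_0`. -/
def projConst (k : Type u) [Field k] (n : ℕ) : k →+* Γ(projSpace k n, ⊤) :=
  ((Proj.toSpecZero (coordGrading k n)).appTop.hom.comp
    (Scheme.ΓSpecIso (.of (coordGrading k n 0))).inv.hom).comp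
      (algebraMap k (coordGrading k n 0))

/-- The regular function `x_j / x_i` on the standard open set `D₊(x_i)` of `ℙⁿ`. -/
def projRatio (k : Type u) [Field k] (n : ℕ) (i j : Fin (n + 1)) :
    Γ(projSpace k n, Proj.basicOpen (coordGrading k n) (MvPolynomial.X i)) :=
  (Proj.awayToSection (coordGrading k n) (MvPolynomial.X i)).hom
    (HomogeneousLocalization.Away.mk (coordGrading k n) (X_mem k n i) 1 (MvPolynomial.X j)
      (by simpa using X_mem k n j))

theorem projRatio_val (k : Type u) [Field k] (n : ℕ) (i j : Fin (n + 1))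
    {V : (projSpace k n).Opens}
    (hi : V ≤ Proj.basicOpen (coordGrading k n) (MvPolynomial.X i)) (x : V) :
    (((projSpace k n).presheaf.map (homOfLE hi).op (projRatio k n i j)).1 x).val =
      Localization.mk (MvPolynomial.X j) ⟨MvPolynomial.X i, hi x.2⟩ := by
  refine (ProjectiveSpectrum.Proj.awayToSection_apply (coordGrading k n) _ _ _).trans ?_
  rw [HomogeneousLocalization.Away.val_mk, Localization.mk_eq_mk', IsLocalization.map_mk',
    Localization.mk_eq_mk']
  simp only [pow_one, RingHom.id_apply]
  rfl

/-- `x_l / x_i = (x_j / x_i) (x_l / x_j)`. -/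
theorem projRatio_mul (k : Type u) [Field k] (n : ℕ) (i j l : Fin (n + 1))
    {V : (projSpace k n).Opens}
    (hi : V ≤ Proj.basicOpen (coordGrading k n) (MvPolynomial.X i))
    (hj : V ≤ Proj.basicOpen (coordGrading k n) (MvPolynomial.X j)) :
    (projSpace k n).presheaf.map (homOfLE hi).op (projRatio k n i l) =
      (projSpace k n).presheaf.map (homOfLE hi).op (projRatio k n i j) *
      (projSpace k n).presheaf.map (homOfLE hj).op (projRatio k n j l) := by
  apply Subtype.ext
  funext x
  apply HomogeneousLocalization.val_injective
  refine Eq.trans ?_ (HomogeneousLocalization.val_mul _ _).symm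
  refine (projRatio_val k n i l hi x).trans ?_
  refine Eq.trans ?_ (congrArg₂ (· * ·) (projRatio_val k n i j hi x)
    (projRatio_val k n j l hj x)).symm
  dsimp only
  rw [Localization.mk_mul, Localization.mk_eq_mk_iff, Localization.r_iff_exists]
  refine ⟨1, ?_⟩
  simp
  ring

theorem projRatio_self (k : Type u) [Field k] (n : ℕ) (i : Fin (n + 1)) :
    projRatio k n i i = 1 := by
  have h : HomogeneousLocalization.Away.mk (coordGrading k n) (X_mem k n i) 1 (MvPolynomial.X i)
      (by simpa using X_mem k n i) = 1 := by
    apply HomogeneousLocalization.val_injective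
    rw [HomogeneousLocalization.Away.val_mk, HomogeneousLocalization.val_one,
      ← Localization.mk_one, Localization.mk_eq_mk_iff, Localization.r_iff_exists]
    exact ⟨1, by simp⟩
  rw [projRatio, h, map_one]

/-! ### Charts of a subscheme of projective space -/

section Charts

variable {k : Type u} [Field k] {n : ℕ} {X : Scheme.{u}} (ι : X ⟶ projSpace k n)

/-- The open set `U_i = X ∩ D₊(x_i)`. -/
abbrev chart (i : Fin (n + 1)) : X.Opens :=
  ι ⁻¹ᵁ Proj.basicOpen (coordGrading k n) (MvPolynomial.X i)

/-- The constants `k → Γ(X, 𝒪_X)`. -/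
def const : k →+* Γ(X, ⊤) := ι.appTop.hom.comp (projConst k n)

/-- The constants `k → Γ(U, 𝒪_X)`. -/
def constOn (U : X.Opens) : k →+* Γ(X, U) :=
  (X.presheaf.map (homOfLE le_top).op).hom.comp (const ι)

/-- The function `x_j / x_i` on `U_i`. -/
def ratio (i j : Fin (n + 1)) : Γ(X, chart ι i) := ι.app _ (projRatio k n i j)

theorem ratio_self (i : Fin (n + 1)) : ratio ι i i = 1 := by
  rw [ratio, projRatio_self, map_one]

theorem ratio_mul (i j l : Fin (n + 1)) :
    X.presheaf.map (homOfLE (inf_le_left : chart ι i ⊓ chart ι j ≤ chart ι i)).op (ratio ι i l) =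
      X.presheaf.map (homOfLE (inf_le_left : chart ι i ⊓ chart ι j ≤ chart ι i)).op (ratio ι i j) *
      X.presheaf.map (homOfLE (inf_le_right : chart ι i ⊓ chart ι j ≤ chart ι j)).op
        (ratio ι j l) := by
  have h := congrArg (ι.app _) (projRatio_mul k n i j l
    (inf_le_left : Proj.basicOpen (coordGrading k n) (MvPolynomial.X i) ⊓
      Proj.basicOpen (coordGrading k n) (MvPolynomial.X j) ≤ _) inf_le_right)
  rw [map_mul] at h
  have nat : ∀ {U V : (projSpace k n).Opens} (e : V ≤ U) (a : Γ(projSpace k n, U)),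
      ι.app V ((projSpace k n).presheaf.map (homOfLE e).op a) =
        X.presheaf.map (homOfLE (show ι ⁻¹ᵁ V ≤ ι ⁻¹ᵁ U from fun _ hx => e hx)).op (ι.app U a) :=
    fun e a => congr($(ι.naturality (homOfLE e).op) a)
  rw [nat, nat, nat] at h
  exact h

/-- The transition function `x_j / x_i`, a unit on `U_i ∩ U_j` with inverse `x_i / x_j`. -/
def transition (i j : Fin (n + 1)) : (Γ(X, chart ι i ⊓ chart ι j))ˣ where
  val := X.presheaf.map (homOfLE inf_le_left).op (ratio ι i j)
  inv := X.presheaf.map (homOfLE inf_le_right).op (ratio ι j i)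
  val_inv := by rw [← ratio_mul, ratio_self, map_one]
  inv_val := by rw [mul_comm, ← ratio_mul, ratio_self, map_one]

end Charts

/-! ### Sheaves of modules -/

instance (X : Scheme.{u}) : HasFiniteBiproducts X.Modules := Abelian.hasFiniteBiproducts

/-- Restriction of sections of a sheaf of modules. -/
abbrev res {X : Scheme.{u}} (E : X.Modules) {U V : X.Opens} (h : V ≤ U) : Γ(E, U) →+ Γ(E, V) :=
  (E.presheaf.map (homOfLE h).op).hom

/-- Multiplication by a global function `c`, as an endomorphism of `E`. -/
def scalarEnd {X : Scheme.{u}} (E : X.Modules) (c : Γ(X, ⊤)) : End E :=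
  ⟨PresheafOfModules.homMk (M₁ := E.val) (M₂ := E.val)
    { app := fun U => E.smul (X.presheaf.map (homOfLE (le_top : U.unop ≤ ⊤)).op c)
      naturality := by
        intro U V i
        have h := Scheme.Modules.map_comp_smul (M := E) i.unop
          (X.presheaf.map (homOfLE (le_top : U.unop ≤ ⊤)).op c)
        rw [← CommRingCat.comp_apply, ← X.presheaf.map_comp] at h
        exact h.symm }
    (fun U r m => by
      have h : ∀ (a b : Γ(X, U.unop)) (t : Γ(E, U.unop)), a • b • t = b • a • t := smul_comm
      exact h _ r m)⟩

/-- A vector bundle: a sheaf of modules that is locally isomorphic to a free sheaf of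
finite rank. -/
def IsVectorBundle {X : Scheme.{u}} (E : X.Modules) : Prop :=
  ∃ q : SheafOfModules.LocalGeneratorsData.{u} E, q.IsLocallyFreeData ∧ q.IsFiniteType

/-- The action of an endomorphism of `E` on the sections over `U`, as a linear map. -/
def sectionsMap {X : Scheme.{u}} {E : X.Modules} (f : End E) (U : X.Opens) :
    Γ(E, U) →ₗ[Γ(X, U)] Γ(E, U) where
  toFun s := Scheme.Modules.Hom.app f U s
  map_add' := map_add _
  map_smul' r s := Scheme.Modules.Hom.app_smul f r s

/-- `det f = c` for an endomorphism `f` of a vector bundle and a global function `c`: over each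
affine open set `U` on which `E` is trivial, the determinant of `f` is `c`. -/
def HasDet {X : Scheme.{u}} {E : X.Modules} (f : End E) (c : Γ(X, ⊤)) : Prop :=
  ∀ U : X.Opens, IsAffineOpen U → Module.Free Γ(X, U) Γ(E, U) →
    LinearMap.det (sectionsMap f U) = X.presheaf.map (homOfLE le_top).op c

/-! ### Twisted global sections -/

section Twisted

variable {k : Type u} [Field k] {n : ℕ} {X : Scheme.{u}} (ι : X ⟶ projSpace k n) (E : X.Modules)

/-- The element `c ∈ k` is an eigenvalue of `f` if `det (f - c · id) = 0`. -/
def IsEigenvalue {E : X.Modules} (f : End E) (c : k) : Prop :=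
  HasDet (f - scalarEnd E (const ι c)) 0

/-- Sections of `E` over the chart `U_i`, as a vector space over `k`. -/
def ChartSections (i : Fin (n + 1)) : Type u := Γ(E, chart ι i)

instance (i : Fin (n + 1)) : AddCommGroup (ChartSections ι E i) :=
  inferInstanceAs (AddCommGroup Γ(E, chart ι i))

instance (i : Fin (n + 1)) : Module Γ(X, chart ι i) (ChartSections ι E i) :=
  inferInstanceAs (Module Γ(X, chart ι i) Γ(E, chart ι i))

instance (i : Fin (n + 1)) : Module k (ChartSections ι E i) :=
  Module.compHom _ (constOn ι (chart ι i))

/-- Restriction of a section over `U_i` to a smaller open set. -/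
def chartRes {i : Fin (n + 1)} {V : X.Opens} (h : V ≤ chart ι i) :
    ChartSections ι E i →+ Γ(E, V) :=
  res E h

theorem chartRes_smul {i : Fin (n + 1)} {V : X.Opens} (h : V ≤ chart ι i) (a : Γ(X, chart ι i))
    (s : ChartSections ι E i) :
    chartRes ι E h (a • s) = X.presheaf.map (homOfLE h).op a • chartRes ι E h s :=
  Scheme.Modules.map_smul E (homOfLE h) a s

theorem const_smul_def {i : Fin (n + 1)} (c : k) (s : ChartSections ι E i) :
    c • s = constOn ι (chart ι i) c • s := rfl

theorem res_constOn {U V : X.Opens} (h : V ≤ U) (c : k) :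
    X.presheaf.map (homOfLE h).op (constOn ι U c) = constOn ι V c := by
  simp only [constOn, RingHom.comp_apply]
  rw [← CommRingCat.comp_apply, ← X.presheaf.map_comp]
  rfl

theorem chartRes_const_smul {i : Fin (n + 1)} {V : X.Opens} (h : V ≤ chart ι i) (c : k)
    (s : ChartSections ι E i) :
    chartRes ι E h (c • s) = constOn ι V c • chartRes ι E h s := by
  rw [const_smul_def, chartRes_smul, res_constOn]

/-- The space `H⁰(X, E(d))`, where `E(d) = E ⊗ 𝒪_X(d)` and `𝒪_X(1)` is the restriction of
`𝒪(1)` from projective space.  Since `𝒪_X(d)` is free on `U_i` with generator `x_i ^ d`, a section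
`s` of `E(d)` is given by the sections `s_i = s / x_i ^ d` of `E` over the `U_i`, subject to
`s_i = (x_j / x_i) ^ d s_j` on `U_i ∩ U_j`. -/
def twistedSections (d : ℤ) : Submodule k (∀ i, ChartSections ι E i) where
  carrier := {s | ∀ i j, chartRes ι E (inf_le_left : chart ι i ⊓ chart ι j ≤ _) (s i) =
    ((transition ι i j ^ d : (Γ(X, chart ι i ⊓ chart ι j))ˣ) : Γ(X, chart ι i ⊓ chart ι j)) •
      chartRes ι E (inf_le_right : chart ι i ⊓ chart ι j ≤ _) (s j)}
  add_mem' {s t} hs ht i j := by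
    simp only [Pi.add_apply, map_add, smul_add, hs i j, ht i j]
  zero_mem' i j := by simp
  smul_mem' c s hs i j := by
    simp only [Pi.smul_apply, chartRes_const_smul, hs i j]
    rw [smul_comm]

/-- Multiplication by the coordinate `x_l`, from `H⁰(X, E(d))` to `H⁰(X, E(d + 1))`. -/
def mulCoord (l : Fin (n + 1)) (d : ℤ) :
    twistedSections ι E d →ₗ[k] twistedSections ι E (d + 1) where
  toFun s := ⟨fun i => ratio ι i l • s.1 i, fun i j => by
    rw [chartRes_smul, chartRes_smul, s.2 i j, ratio_mul ι i j l, zpow_add_one, Units.val_mul,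
      mul_smul, smul_smul, smul_smul, smul_smul]
    congr 1
    rw [show ((transition ι i j : (Γ(X, chart ι i ⊓ chart ι j))ˣ) :
      Γ(X, chart ι i ⊓ chart ι j)) =
        X.presheaf.map (homOfLE inf_le_left).op (ratio ι i j) from rfl]
    ring⟩
  map_add' s t := by
    apply Subtype.ext
    funext i
    exact smul_add _ _ _
  map_smul' c s := by
    apply Subtype.ext
    funext i
    exact smul_comm (ratio ι i l) (constOn ι (chart ι i) c) (s.1 i)

/-- The graded module `Γ_*(E) = ⨁_d H⁰(X, E(d))`. -/
def GammaStar : Type u := DirectSum ℤ fun d => twistedSections ι E d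

instance : AddCommGroup (GammaStar ι E) :=
  inferInstanceAs (AddCommGroup (DirectSum ℤ fun d => twistedSections ι E d))

instance : Module k (GammaStar ι E) :=
  inferInstanceAs (Module k (DirectSum ℤ fun d => twistedSections ι E d))

/-- The inclusion of the homogeneous part of degree `d`. -/
def GammaStar.of (d : ℤ) : twistedSections ι E d →ₗ[k] GammaStar ι E :=
  DirectSum.lof k ℤ (fun d => twistedSections ι E d) d

/-- Multiplication by the coordinate `x_l` on `Γ_*(E)`. -/
def coordEnd (l : Fin (n + 1)) : Module.End k (GammaStar ι E) :=
  DirectSum.toModule k ℤ (GammaStar ι E)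
    fun d => GammaStar.of ι E (d + 1) ∘ₗ mulCoord ι E l d

theorem coordEnd_of (l : Fin (n + 1)) (d : ℤ) (s : twistedSections ι E d) :
    coordEnd ι E l (GammaStar.of ι E d s) = GammaStar.of ι E (d + 1) (mulCoord ι E l d s) :=
  DirectSum.toModule_lof (R := k) (M := fun d => twistedSections ι E d)
    (φ := fun d => GammaStar.of ι E (d + 1) ∘ₗ mulCoord ι E l d) d s

theorem coordEnd_comm (l m : Fin (n + 1)) :
    coordEnd ι E l * coordEnd ι E m = coordEnd ι E m * coordEnd ι E l := by
  refine DirectSum.linearMap_ext k (M := fun d => twistedSections ι E d) fun d => ?_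
  ext s : 1
  change coordEnd ι E l (coordEnd ι E m (GammaStar.of ι E d s)) =
    coordEnd ι E m (coordEnd ι E l (GammaStar.of ι E d s))
  rw [coordEnd_of, coordEnd_of, coordEnd_of, coordEnd_of]
  congr 1
  apply Subtype.ext
  funext i
  exact smul_comm (ratio ι i l) (ratio ι i m) (s.1 i)

instance : IsMulCommutative (Algebra.adjoin k (Set.range (coordEnd ι E))) :=
  Algebra.isMulCommutative_adjoin k (by
    rintro _ ⟨l, rfl⟩ _ ⟨m, rfl⟩
    exact coordEnd_comm ι E l m)

open scoped IsMulCommutative in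
/-- The action of `k[x_0, …, x_n]` on `Γ_*(E)`. -/
def coordAction : MvPolynomial (Fin (n + 1)) k →ₐ[k] Module.End k (GammaStar ι E) :=
  (Algebra.adjoin k (Set.range (coordEnd ι E))).val.comp
    (MvPolynomial.aeval fun l => ⟨coordEnd ι E l, Algebra.subset_adjoin ⟨l, rfl⟩⟩)

theorem coordAction_X (l : Fin (n + 1)) : coordAction ι E (MvPolynomial.X l) = coordEnd ι E l := by
  simp [coordAction]

/-- `Γ_*(E)` as a module over `k[x_0, …, x_n]`.  The action factors through the homogeneous
coordinate ring `R` of `X`, which is a quotient of `k[x_0, …, x_n]`; hence submodules, linear maps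
and the quotient by the irrelevant ideal are the same over either ring. -/
instance : Module (MvPolynomial (Fin (n + 1)) k) (GammaStar ι E) :=
  Module.compHom _ (coordAction ι E).toRingHom

theorem smul_def' (p : MvPolynomial (Fin (n + 1)) k) (s : GammaStar ι E) :
    p • s = coordAction ι E p s := rfl

instance : IsScalarTower k (MvPolynomial (Fin (n + 1)) k) (GammaStar ι E) where
  smul_assoc c p s := by rw [smul_def', smul_def', map_smul, LinearMap.smul_apply]

variable {E}

/-- The map `H⁰(X, E(d)) → H⁰(X, E(d))` induced by an endomorphism of `E`. -/
def twistedMap (f : End E) (d : ℤ) : twistedSections ι E d →ₗ[k] twistedSections ι E d where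
  toFun s := ⟨fun i => sectionsMap f (chart ι i) (s.1 i), fun i j => by
    have nat : ∀ {U V : X.Opens} (h : V ≤ U) (t : Γ(E, U)),
        res E h (sectionsMap f U t) = sectionsMap f V (res E h t) := fun h t =>
      (congr($((Scheme.Modules.Hom.mapPresheaf f).naturality (homOfLE h).op) t)).symm
    have e := s.2 i j
    refine (nat inf_le_left (s.1 i)).trans ?_
    refine Eq.trans ?_ (congrArg _ (nat inf_le_right (s.1 j)).symm)
    refine (congrArg _ e).trans ?_
    exact map_smul _ _ _⟩
  map_add' s t := by
    apply Subtype.ext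
    funext i
    exact map_add _ _ _
  map_smul' c s := by
    apply Subtype.ext
    funext i
    exact map_smul (sectionsMap f (chart ι i)) (constOn ι (chart ι i) c) (s.1 i)

/-- `Γ_*(f)` as a `k`-linear map. -/
def gammaStarMapAux (f : End E) : Module.End k (GammaStar ι E) :=
  DirectSum.lmap fun d => twistedMap ι f d

theorem gammaStarMapAux_of (f : End E) (d : ℤ) (s : twistedSections ι E d) :
    gammaStarMapAux ι f (GammaStar.of ι E d s) = GammaStar.of ι E d (twistedMap ι f d s) :=
  DirectSum.lmap_lof _ _ _

theorem gammaStarMapAux_comm (f : End E) (l : Fin (n + 1)) :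
    gammaStarMapAux ι f * coordEnd ι E l = coordEnd ι E l * gammaStarMapAux ι f := by
  refine DirectSum.linearMap_ext k (M := fun d => twistedSections ι E d) fun d => ?_
  ext s : 1
  change gammaStarMapAux ι f (coordEnd ι E l (GammaStar.of ι E d s)) =
    coordEnd ι E l (gammaStarMapAux ι f (GammaStar.of ι E d s))
  rw [coordEnd_of, gammaStarMapAux_of, gammaStarMapAux_of, coordEnd_of]
  congr 1
  apply Subtype.ext
  funext i
  exact map_smul (sectionsMap f (chart ι i)) (ratio ι i l) (s.1 i)

/-- The endomorphism `Γ_*(f)` of the graded module `Γ_*(E)`. -/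
def gammaStarMap (f : End E) :
    Module.End (MvPolynomial (Fin (n + 1)) k) (GammaStar ι E) where
  toFun := gammaStarMapAux ι f
  map_add' := map_add _
  map_smul' p s := by
    rw [RingHom.id_apply, smul_def', smul_def']
    induction p using MvPolynomial.induction_on generalizing s with
    | C c =>
      rw [← MvPolynomial.algebraMap_eq, AlgHom.commutes, Module.algebraMap_end_apply,
        Module.algebraMap_end_apply, map_smul]
    | add p q hp hq => rw [map_add, LinearMap.add_apply, LinearMap.add_apply, map_add, hp, hq]
    | mul_X p l hp =>
      rw [map_mul, coordAction_X, Module.End.mul_apply, Module.End.mul_apply, hp]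
      congr 1
      exact LinearMap.congr_fun (gammaStarMapAux_comm ι f l) s

/-! ### Module-theoretic multiplicities -/

/-- The irrelevant maximal ideal `𝔪 = (x_0, …, x_n)`. -/
def irrelevantIdeal (k : Type u) [Field k] (n : ℕ) : Ideal (MvPolynomial (Fin (n + 1)) k) :=
  Ideal.span (Set.range MvPolynomial.X)

/-- The submodule `𝔪 M` of `M = Γ_*(E)`. -/
def irrelevantPart (ι : X ⟶ projSpace k n) (E : X.Modules) :
    Submodule (MvPolynomial (Fin (n + 1)) k) (GammaStar ι E) :=
  irrelevantIdeal k n • ⊤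

/-- The `k`-linear map `A : M / 𝔪 M → M / 𝔪 M` induced by an endomorphism `φ` of
`M = Γ_*(E)`. -/
def fiberMap (φ : Module.End (MvPolynomial (Fin (n + 1)) k) (GammaStar ι E)) :
    Module.End k (GammaStar ι E ⧸ irrelevantPart ι E) :=
  ((irrelevantPart ι E).mapQ (irrelevantPart ι E) φ
    (Submodule.smul_top_le_comap_smul_top _ _)).restrictScalars k

/-- The module-theoretic multiplicity of `c` as an eigenvalue of `φ`: the algebraic multiplicity
of the eigenvalue `c` of `A : M / 𝔪 M → M / 𝔪 M`, i.e. the dimension of the generalized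
eigenspace of `A` for `c`. -/
def moduleMultiplicity (φ : Module.End (MvPolynomial (Fin (n + 1)) k) (GammaStar ι E)) (c : k) :
    ℕ :=
  Module.finrank k ((fiberMap ι φ).maxGenEigenspace c)

/-! ### The sheaf associated to a graded submodule -/

/-- For a graded submodule `N` of `Γ_*(E)`, the section `s ∈ Γ(U, E)` belongs to the subsheaf
associated to `N`: locally, it is a linear combination, with regular functions as coefficients,
of the sections `m / x_j ^ d` of `E` over `U_j` for homogeneous `m ∈ N` of degree `d`. -/
def MemAssociatedSheaf (N : Submodule (MvPolynomial (Fin (n + 1)) k) (GammaStar ι E))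
    (U : X.Opens) (s : Γ(E, U)) : Prop :=
  ∀ x ∈ U, ∃ (j : Fin (n + 1)) (V : X.Opens) (hU : V ≤ U) (hj : V ≤ chart ι j), x ∈ V ∧
    res E hU s ∈ Submodule.span Γ(X, V)
      {t | ∃ (d : ℤ) (m : twistedSections ι E d), GammaStar.of ι E d m ∈ N ∧
        t = chartRes ι E hj (m.1 j)}

end Twisted

end BundleDecomposition

end

noncomputable section
namespace BundleDecomposition

/-! Write S = k[x_0, …, x_n], M = Γ_*(E) and φ = Γ_*(f). Everything follows from one polynomial over
k that annihilates f and has the form ∏ (T - λ_i)^{μ_i} · q with q coprime to the product. Bézout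
then writes 1 as ∑ e_i + e₀ with polynomials in f that act as the projections onto the ker g_i and
im g (`exists_spectralPartition`). As Γ_* is a ring homomorphism on endomorphisms, the same elements
split M. A summand of E and the sheaf associated to the matching summand of M both consist of the
sections fixed by the same projection, so they agree.

If M is finitely generated, the polynomial is the characteristic polynomial χ of A on M/𝔪M, in which
λ_i is a root of multiplicity exactly μ_i. To see χ(φ) = 0, lift a basis of M/𝔪M to M. Nakayama
gives s ≡ 1 mod 𝔪 with sM inside the span of the lifts, and Cayley–Hamilton for sφ gives a
polynomial over S that kills φ and reduces to χ modulo 𝔪 (`aeval_charpoly_mapQ`). Since φ preserves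
degrees, the degree-preserving part of this identity is χ(φ) = 0
(`aeval_constantCoeff_gammaStarMap`). Twisted sections generate E locally, so Γ_* is faithful and
χ(f) = 0 (`IsVectorBundle.eq_zero_of_gammaStarMap_eq_zero`).

Fix j with U_j nonempty. If x_j has no zero on X, then M = 𝔪M, every μ_i is 0, every g_i is the
identity, and q = 0 serves. If x_j has a zero on X, then M is finitely generated
(`IsVectorBundle.finite_gammaStar`): it is torsion-free over a domain R, a power of each x_l moves
any given element into one finitely generated submodule, and the irrelevant ideal of R has height at
least two. Noether normalization reduces this to a polynomial ring in at least two variables, where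
two coprime variables suffice. -/

/-! ### Local coordinates on a vector bundle -/

/-- An isomorphism from a finite power of `P` is given by inclusions and projections. -/
theorem exists_biproduct_maps {C : Type*} [Category* C] [Preadditive C] {P F : C} {I : Type*}
    [Fintype I] [DecidableEq I] {c : Cofan fun _ : I => P} (hc : IsColimit c) (e : c.pt ≅ F) :
    ∃ (a : I → (P ⟶ F)) (p : I → (F ⟶ P)),
      (∀ i j, a i ≫ p j = if i = j then 𝟙 P else 0) ∧ ∑ i, p i ≫ a i = 𝟙 F := by
  let q : I → (c.pt ⟶ P) := fun j =>
    Cofan.IsColimit.desc hc fun i => if i = j then 𝟙 P else 0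
  have hq : ∀ i j, c.inj i ≫ q j = if i = j then 𝟙 P else 0 := fun i j =>
    Cofan.IsColimit.fac hc _ i
  refine ⟨fun i => c.inj i ≫ e.hom, fun j => e.inv ≫ q j, fun i j => by simp [hq], ?_⟩
  have h : ∑ i, q i ≫ c.inj i = 𝟙 c.pt := by
    refine Cofan.IsColimit.hom_ext hc _ _ fun i => ?_
    simp only [Preadditive.comp_sum, Category.comp_id, reassoc_of% hq, ite_comp, 
      Category.id_comp, zero_comp]
    rw [Finset.sum_eq_single i]
    · simp
    · intro j _ hj
      simp [Ne.symm hj]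
    · simp
  have h2 : e.inv ≫ (∑ i, q i ≫ c.inj i) ≫ e.hom = 𝟙 F := by simp [h]
  simpa [Preadditive.comp_sum, Preadditive.sum_comp] using h2

theorem IsVectorBundle.exists_biproduct_maps {X : Scheme.{u}} {E : X.Modules}
    (hE : IsVectorBundle E) (x : X) : ∃ W : X.Opens, x ∈ W ∧ ∃ (I : Type u) (_ : Fintype I)
      (_ : DecidableEq I)
      (a : I → (SheafOfModules.unit (X.ringCatSheaf.over W) ⟶ SheafOfModules.over E W))
      (p : I → (SheafOfModules.over E W ⟶ SheafOfModules.unit (X.ringCatSheaf.over W))),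
      (∀ i j, a i ≫ p j = if i = j then 𝟙 _ else 0) ∧ ∑ i, p i ≫ a i = 𝟙 _ := by
  obtain ⟨q, h₁, h₂⟩ := hE
  obtain ⟨V, f, ⟨i, ⟨g⟩⟩, hx⟩ := q.coversTop ⊤ x trivial
  refine ⟨q.X i, leOfHom g hx, (q.generators i).I, ?_⟩
  have := h₁.isIso i
  have := (h₂.isFiniteType i).finite
  have := Fintype.ofFinite (q.generators i).I
  classical
  exact ⟨inferInstance, inferInstance, BundleDecomposition.exists_biproduct_maps
    (SheafOfModules.isColimitFreeCofan _) (@asIso _ _ _ _ _ (h₁.isIso i))⟩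

/-- On the open subsets of `W`, the sheaf `E` has coordinates in a finite power of `𝒪_X`. -/
def HasCoordinates {X : Scheme.{u}} (E : X.Modules) (W : X.Opens) : Prop :=
  ∃ (I : Type u) (_ : Fintype I) (c : ∀ V : X.Opens, V ≤ W → (Γ(E, V) ≃ₗ[Γ(X, V)] (I → Γ(X, V)))),
    ∀ (V V' : X.Opens) (h : V ≤ W) (h' : V' ≤ V) (s : Γ(E, V)) (i : I),
      c V' (h'.trans h) (res E h' s) i = X.presheaf.map (homOfLE h').op (c V h s i)

/-- The local inclusions and projections are morphisms of sheaves on the slice over W. Evaluated at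
the opens V ≤ W they give coordinates, and naturality of the projections gives compatibility with
restriction. -/
theorem IsVectorBundle.exists_hasCoordinates {X : Scheme.{u}} {E : X.Modules}
    (hE : IsVectorBundle E) (x : X) : ∃ W : X.Opens, x ∈ W ∧ HasCoordinates E W := by
  obtain ⟨W, hx, I, _, _, a, p, hap, hpa⟩ := hE.exists_biproduct_maps x
  refine ⟨W, hx, I, inferInstance, ?_⟩
  let pl : ∀ (V : X.Opens) (h : V ≤ W) (i : I), Γ(E, V) →ₗ[Γ(X, V)] Γ(X, V) := fun V h i =>
    ((p i).val.app (.op (Over.mk (homOfLE h)))).hom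
  let al : ∀ (V : X.Opens) (h : V ≤ W) (i : I), Γ(X, V) →ₗ[Γ(X, V)] Γ(E, V) := fun V h i =>
    ((a i).val.app (.op (Over.mk (homOfLE h)))).hom
  have h1 : ∀ (V : X.Opens) (h : V ≤ W) (i j : I) (r : Γ(X, V)),
      pl V h j (al V h i r) = if i = j then r else 0 := by
    intro V h i j r
    have := congr(($(hap i j)).val.app (.op (Over.mk (homOfLE h))) r)
    refine this.trans ?_
    split_ifs <;> rfl
  have h2 : ∀ (V : X.Opens) (h : V ≤ W) (s : Γ(E, V)), ∑ i, al V h i (pl V h i s) = s := by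
    intro V h s
    -- Evaluation at s is additive in the morphism, so it passes through the sum in `hpa`.
    let ev : (SheafOfModules.over E W ⟶ SheafOfModules.over E W) →+ Γ(E, V) :=
      { toFun := fun f => f.val.app (.op (Over.mk (homOfLE h))) s
        map_zero' := rfl
        map_add' := fun _ _ => rfl }
    have := congrArg ev hpa
    rw [map_sum] at this
    exact this
  refine ⟨fun V h => 
    { toFun := fun s i => pl V h i s
      map_add' := fun s t => by ext i; exact map_add _ _ _
      map_smul' := fun r s => by ext i; exact map_smul (pl V h i) r s
      invFun := fun r => ∑ i, al V h i (r i)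
      left_inv := fun s => h2 V h s
      right_inv := fun r => by
        ext j
        simp [map_sum, h1] }, ?_⟩
  intro V V' h h' s i
  exact PresheafOfModules.naturality_apply (p i).val
    (Over.homMk (homOfLE h') : Over.mk (homOfLE (h'.trans h)) ⟶ Over.mk (homOfLE h)).op s


/-! ### Gluing, extending and generating sections of a vector bundle -/

section Restriction

variable {X : Scheme.{u}} (E : X.Modules)

theorem res_res {U V W : X.Opens} (h : V ≤ U) (h' : W ≤ V) (s : Γ(E, U)) :
    res E h' (res E h s) = res E (h'.trans h) s := by
  have : E.presheaf.map (homOfLE (h'.trans h)).op =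
      E.presheaf.map (homOfLE h).op ≫ E.presheaf.map (homOfLE h').op := by
    rw [← Functor.map_comp]
    rfl
  exact congr($this s).symm

theorem res_smul {U V : X.Opens} (h : V ≤ U) (a : Γ(X, U)) (s : Γ(E, U)) :
    res E h (a • s) = X.presheaf.map (homOfLE h).op a • res E h s :=
  Scheme.Modules.map_smul E (homOfLE h) a s

theorem fun_res_res {U V W : X.Opens} (h : V ≤ U) (h' : W ≤ V) (a : Γ(X, U)) :
    X.presheaf.map (homOfLE h').op (X.presheaf.map (homOfLE h).op a) =
      X.presheaf.map (homOfLE (h'.trans h)).op a := by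
  rw [← CommRingCat.comp_apply, ← X.presheaf.map_comp]
  rfl

theorem section_ext {κ : Type*} {U : X.Opens} (W : κ → X.Opens) (hW : ∀ i, W i ≤ U)
    (hU : U ≤ iSup W) {s t : Γ(E, U)} (h : ∀ i, res E (hW i) s = res E (hW i) t) : s = t :=
  TopCat.Sheaf.eq_of_locally_eq' ⟨E.presheaf, E.isSheaf⟩ W U (fun i => homOfLE (hW i)) hU s t h

theorem exists_glue {κ : Type*} {U : X.Opens} (W : κ → X.Opens) (hW : ∀ i, W i ≤ U)
    (hU : U ≤ iSup W) (s : ∀ i, Γ(E, W i))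
    (h : ∀ i j, res E (inf_le_left : W i ⊓ W j ≤ W i) (s i) =
      res E (inf_le_right : W i ⊓ W j ≤ W j) (s j)) :
    ∃ t : Γ(E, U), ∀ i, res E (hW i) t = s i :=
  (TopCat.Sheaf.existsUnique_gluing' ⟨E.presheaf, E.isSheaf⟩ W U (fun i => homOfLE (hW i)) hU s
    h).exists

theorem section_eq_zero_of_isEmpty {U : X.Opens} (hU : ¬ (U : Set X).Nonempty)
    (s : Γ(E, U)) : s = 0 :=
  section_ext E (κ := Empty) Empty.elim (fun i => i.elim) (fun x hx => (hU ⟨x, hx⟩).elim)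
    fun i => i.elim

variable {E}

theorem HasCoordinates.mono {W W' : X.Opens} (hW : HasCoordinates E W) (h : W' ≤ W) :
    HasCoordinates E W' := by
  obtain ⟨I, _, c, hc⟩ := hW
  exact ⟨I, inferInstance, fun V hV => c V (hV.trans h), fun V V' hV => hc V V' (hV.trans h)⟩

/-- The functions f whose D(f) lies in a coordinate neighbourhood cover U, hence generate the unit
ideal, and finitely many of them already do. -/
theorem IsVectorBundle.exists_affine_cover (hE : IsVectorBundle E) {U : X.Opens}
    (hU : IsAffineOpen U) : ∃ F : Finset Γ(X, U), Ideal.span (F : Set Γ(X, U)) = ⊤ ∧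
      ∀ f ∈ F, HasCoordinates E (X.basicOpen f) := by
  let S : Set Γ(X, U) := {f | HasCoordinates E (X.basicOpen f)}
  have hS : Ideal.span S = ⊤ := by
    rw [← hU.iSup_basicOpen_eq_self_iff]
    refine le_antisymm (iSup_le fun f => X.basicOpen_le _) fun x hx => ?_
    obtain ⟨W, hxW, hW⟩ := hE.exists_hasCoordinates x
    obtain ⟨f, hf, hxf⟩ := hU.exists_basicOpen_le ⟨x, hxW⟩ hx
    exact TopologicalSpace.Opens.mem_iSup.2 ⟨⟨f, hW.mono hf⟩, hxf⟩
  obtain ⟨F, hF, hF'⟩ := (Ideal.span_eq_top_iff_finite S).1 hS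
  exact ⟨F, hF', fun f hf => hF hf⟩

theorem le_iSup_basicOpen {U : X.Opens} (hU : IsAffineOpen U) {F : Finset Γ(X, U)}
    (hF : Ideal.span (F : Set Γ(X, U)) = ⊤) : U ≤ ⨆ f : F, X.basicOpen f.1 :=
  (hU.iSup_basicOpen_eq_self_iff.2 hF).ge

theorem exists_unit_res {U V : X.Opens} (h : Γ(X, U)) (hV : V ≤ X.basicOpen h) :
    IsUnit (X.presheaf.map (homOfLE (hV.trans (X.basicOpen_le h))).op h) := by
  have := (RingedSpace.isUnit_res_basicOpen X.toRingedSpace h).map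
    (X.presheaf.map (homOfLE hV).op).hom
  rw [← fun_res_res (X.basicOpen_le h) hV]
  exact this

/-- Coordinates reduce this to functions, where the functions on D(h) are the localization of those
on W at h. -/
theorem HasCoordinates.exists_extension {W V : X.Opens} (hE : HasCoordinates E W)
    (hW : IsAffineOpen W) (h : Γ(X, W)) (hVW : V ≤ W) (hV : V = X.basicOpen h) (s : Γ(E, V)) :
    ∃ (N : ℕ) (t : Γ(E, W)), res E hVW t = X.presheaf.map (homOfLE hVW).op h ^ N • s := by
  obtain ⟨I, _, c, hc⟩ := hE
  have hloc := hW.isLocalization_of_eq_basicOpen h (homOfLE hVW) hV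
  have : ∀ i, ∃ (N : ℕ) (a : Γ(X, W)), X.presheaf.map (homOfLE hVW).op a =
      X.presheaf.map (homOfLE hVW).op h ^ N * c V hVW s i := fun i => by
    let := (X.presheaf.map (homOfLE hVW).op).hom.toAlgebra
    obtain ⟨N, a, e⟩ := IsLocalization.Away.surj (S := Γ(X, V)) h (c V hVW s i)
    exact ⟨N, a, by rw [mul_comm]; exact e.symm⟩
  choose N a ha using this
  -- The sum of the exponents bounds each of them, so it serves as a common denominator.
  refine ⟨∑ i, N i, (c W le_rfl).symm fun i => h ^ (∑ j, N j - N i) * a i, ?_⟩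
  apply (c V hVW).injective
  funext i
  have h1 := hc W V le_rfl hVW ((c W le_rfl).symm fun i => h ^ (∑ j, N j - N i) * a i) i
  rw [LinearEquiv.apply_symm_apply] at h1
  refine h1.trans ?_
  rw [map_mul, map_pow, ha, ← mul_assoc, ← pow_add, map_smul, Pi.smul_apply, smul_eq_mul,
    Nat.sub_add_cancel (Finset.single_le_sum (f := N) (fun _ _ => Nat.zero_le _)
      (Finset.mem_univ i))]

variable [IsIntegral X]

theorem inf_nonempty {U V : X.Opens} (hU : (U : Set X).Nonempty) (hV : (V : Set X).Nonempty) :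
    ((U ⊓ V : X.Opens) : Set X).Nonempty :=
  nonempty_preirreducible_inter U.2 V.2 hU hV

/-- Sections of a vector bundle on an integral scheme are determined on any nonempty open set. -/
theorem IsVectorBundle.ext_of_nonempty (hE : IsVectorBundle E) {U V : X.Opens}
    (hV : (V : Set X).Nonempty) (s t : Γ(E, U))
    (h : res E (inf_le_left : U ⊓ V ≤ U) s = res E (inf_le_left : U ⊓ V ≤ U) t) : s = t := by
  choose W hx hW using hE.exists_hasCoordinates
  refine section_ext E (fun x : U => U ⊓ W x) (fun _ => inf_le_left)
    (fun x hxU => TopologicalSpace.Opens.mem_iSup.2 ⟨⟨x, hxU⟩, hxU, hx x⟩) fun x => ?_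
  obtain ⟨I, _, c, hc⟩ := hW x
  apply (c _ inf_le_right).injective
  funext i
  -- By irreducibility U ∩ W_x meets V, and on an integral scheme functions restrict injectively to
  -- nonempty opens; this settles each coordinate.
  obtain ⟨y, hy⟩ : ((U ⊓ W x ⊓ V : X.Opens) : Set X).Nonempty :=
    inf_nonempty ⟨x, x.2, hx x⟩ hV
  have : Nonempty (U ⊓ W x ⊓ V : X.Opens) := ⟨⟨y, hy⟩⟩
  apply map_injective_of_isIntegral X
    (homOfLE (inf_le_left : (U ⊓ W x) ⊓ V ≤ U ⊓ W x))
  rw [← hc _ _ inf_le_right inf_le_left, ← hc _ _ inf_le_right inf_le_left, res_res, res_res]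
  have := congrArg (res E (show (U ⊓ W x) ⊓ V ≤ U ⊓ V from inf_le_inf_right _ inf_le_left)) h
  rw [res_res, res_res] at this
  exact congrArg (fun z => c _ _ z i) this

theorem IsVectorBundle.res_injective (hE : IsVectorBundle E) {U V : X.Opens} (hVU : V ≤ U)
    (hV : (V : Set X).Nonempty) : Function.Injective (res E hVU) := fun s t h =>
  hE.ext_of_nonempty hV s t (by
    have := congrArg (res E (inf_le_right : U ⊓ V ≤ V)) h
    rwa [res_res, res_res] at this)

theorem IsVectorBundle.smul_eq_zero (hE : IsVectorBundle E) {U : X.Opens} {a : Γ(X, U)}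
    {s : Γ(E, U)} (h : a • s = 0) : a = 0 ∨ s = 0 := by
  by_cases hU : (U : Set X).Nonempty
  swap
  · exact .inr (section_eq_zero_of_isEmpty E hU s)
  obtain ⟨x, hx⟩ := hU
  obtain ⟨W, hxW, I, _, c, hc⟩ := hE.exists_hasCoordinates x
  have hne : ((U ⊓ W : X.Opens) : Set X).Nonempty := ⟨x, hx, hxW⟩
  have : Nonempty (U ⊓ W : X.Opens) := ⟨⟨x, hx, hxW⟩⟩
  by_cases ha : a = 0
  · exact .inl ha
  refine .inr (hE.res_injective (inf_le_left : U ⊓ W ≤ U) hne ?_)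
  rw [map_zero]
  apply (c _ inf_le_right).injective
  funext i
  have h1 := congrArg (fun t => c _ inf_le_right (res E (inf_le_left : U ⊓ W ≤ U) t) i) h
  simp only [res_smul, map_smul, Pi.smul_apply, smul_eq_mul, map_zero, Pi.zero_apply,
    mul_eq_zero] at h1
  rw [map_zero, Pi.zero_apply]
  refine h1.resolve_left fun h2 => ha ?_
  exact map_injective_of_isIntegral X (homOfLE (inf_le_left : U ⊓ W ≤ U))
    (h2.trans (map_zero _).symm)

/-- Over an affine open set `U`, a section over a basic open set `D(h)` extends to `U` after
multiplication by a power of `h`. -/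
theorem IsVectorBundle.exists_extension (hE : IsVectorBundle E) {U V : X.Opens}
    (hU : IsAffineOpen U) (h : Γ(X, U)) (hVU : V ≤ U) (hV : V = X.basicOpen h) (s : Γ(E, V)) :
    ∃ N : ℕ, ∀ m, N ≤ m → ∃ t : Γ(E, U),
      res E hVU t = X.presheaf.map (homOfLE hVU).op h ^ m • s := by
  suffices H : ∃ (N : ℕ) (t : Γ(E, U)), res E hVU t = X.presheaf.map (homOfLE hVU).op h ^ N • s by
    obtain ⟨N, t, ht⟩ := H
    refine ⟨N, fun m hm => ⟨h ^ (m - N) • t, ?_⟩⟩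
    rw [res_smul, ht, map_pow, smul_smul, ← pow_add, Nat.sub_add_cancel hm]
  by_cases hne : (V : Set X).Nonempty
  swap
  · exact ⟨0, 0, (section_eq_zero_of_isEmpty E hne _).trans
      (section_eq_zero_of_isEmpty E hne _).symm⟩
  obtain ⟨F, hF, hFc⟩ := hE.exists_affine_cover hU
  have loc : ∀ f : F, ∃ (N : ℕ) (t : Γ(E, X.basicOpen f.1)),
      res E (inf_le_left : X.basicOpen f.1 ⊓ V ≤ _) t =
        X.presheaf.map (homOfLE (inf_le_right.trans hVU : X.basicOpen f.1 ⊓ V ≤ U)).op h ^ N •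
          res E (inf_le_right : X.basicOpen f.1 ⊓ V ≤ V) s := by
    intro f
    obtain ⟨N, t, ht⟩ := (hFc f.1 f.2).exists_extension (hU.basicOpen f.1)
      (X.presheaf.map (homOfLE (X.basicOpen_le f.1)).op h)
      (inf_le_left : X.basicOpen f.1 ⊓ V ≤ _) (by rw [Scheme.basicOpen_res, hV])
      (res E (inf_le_right : X.basicOpen f.1 ⊓ V ≤ V) s)
    exact ⟨N, t, by rw [ht, fun_res_res]⟩
  choose N t ht using loc
  -- Raising all local extensions to one exponent makes them extend the same section h ^ N₀ • s, as
  -- gluing requires.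
  let N₀ := ∑ f, N f
  have hN : ∀ f, N f ≤ N₀ := fun f =>
    Finset.single_le_sum (f := N) (fun _ _ => Nat.zero_le _) (Finset.mem_univ f)
  obtain ⟨t', ht'⟩ : ∃ t' : ∀ f : F, Γ(E, X.basicOpen f.1),
      ∀ f, res E (inf_le_left : X.basicOpen f.1 ⊓ V ≤ _) (t' f) =
        X.presheaf.map (homOfLE (inf_le_right.trans hVU : X.basicOpen f.1 ⊓ V ≤ U)).op h ^ N₀ •
          res E (inf_le_right : X.basicOpen f.1 ⊓ V ≤ V) s :=
    ⟨fun f => X.presheaf.map (homOfLE (X.basicOpen_le f.1)).op h ^ (N₀ - N f) • t f, fun f => by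
      rw [res_smul, map_pow, fun_res_res, ht, smul_smul, ← pow_add, Nat.sub_add_cancel (hN f)]⟩
  obtain ⟨T, hT⟩ := exists_glue E (fun f : F => X.basicOpen f.1) (fun f => X.basicOpen_le f.1)
    (le_iSup_basicOpen hU hF) t' fun f g => by
      -- Agreement on overlaps need only be checked after intersecting with the nonempty V, where
      -- both extensions are h ^ N₀ • s.
      refine hE.ext_of_nonempty hne _ _ ?_
      have h1 := congrArg (res E (inf_le_inf_right V inf_le_left :
        X.basicOpen f.1 ⊓ X.basicOpen g.1 ⊓ V ≤ _)) (ht' f)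
      have h2 := congrArg (res E (inf_le_inf_right V inf_le_right :
        X.basicOpen f.1 ⊓ X.basicOpen g.1 ⊓ V ≤ _)) (ht' g)
      rw [res_res, res_smul, map_pow, fun_res_res, res_res] at h1 h2
      rw [res_res, res_res, h1, h2]
  refine ⟨N₀, T, ?_⟩
  refine section_ext E (fun f : F => X.basicOpen f.1 ⊓ V) (fun _ => inf_le_right)
    (fun x hx => ?_) fun f => ?_
  · obtain ⟨f, hf⟩ := TopologicalSpace.Opens.mem_iSup.1 (le_iSup_basicOpen hU hF (hVU hx))
    exact TopologicalSpace.Opens.mem_iSup.2 ⟨f, hf, hx⟩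
  · have := congrArg (res E (inf_le_left : X.basicOpen f.1 ⊓ V ≤ _)) (hT f)
    rw [ht', res_res] at this
    rw [res_res, res_smul, map_pow, fun_res_res]
    exact this

/-- The sections of a vector bundle over an affine open set form a finite module. -/
theorem IsVectorBundle.finite_sections (hE : IsVectorBundle E) {U : X.Opens}
    (hU : IsAffineOpen U) : Module.Finite Γ(X, U) Γ(E, U) := by
  by_cases hne : (U : Set X).Nonempty
  swap
  · have : Subsingleton Γ(E, U) := ⟨fun s t => (section_eq_zero_of_isEmpty E hne _).trans
      (section_eq_zero_of_isEmpty E hne _).symm⟩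
    infer_instance
  obtain ⟨F, hF, hFc⟩ := hE.exists_affine_cover hU
  -- Over D(f) there is a finite basis. Powers of f extend its vectors to sections σ over U and
  -- clear the denominators of the coordinates of s, so f ^ K • s lies in the span of the σ. As the
  -- f generate the unit ideal, the local spans together give everything.
  have loc : ∀ f : F, ∃ P : Submodule Γ(X, U) Γ(E, U), P.FG ∧
      ∀ s, ∃ n : ℕ, f.1 ^ n • s ∈ P := by
    rintro ⟨f, hf⟩
    by_cases hfe : ((X.basicOpen f : X.Opens) : Set X).Nonempty
    swap
    · refine ⟨⊥, Submodule.fg_bot, fun s => ⟨1, ?_⟩⟩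
      have h0 : f = 0 := by
        rw [← AlgebraicGeometry.basicOpen_eq_bot_iff]
        exact SetLike.ext' (Set.not_nonempty_iff_eq_empty.1 hfe)
      simp [h0]
    obtain ⟨I, _, c, hc⟩ := hFc f hf
    classical
    have hr : ∀ t : Γ(E, X.basicOpen f), ∑ i, c _ le_rfl t i •
        (c _ le_rfl).symm (Pi.single i 1) = t := fun t => by
      apply (c _ le_rfl).injective
      funext j
      simp [map_sum, Finset.sum_apply, Pi.single_apply]
    have hex : ∀ i, ∃ (N : ℕ) (σ : Γ(E, U)), res E (X.basicOpen_le f) σ =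
        X.presheaf.map (homOfLE (X.basicOpen_le f)).op f ^ N •
          (c _ le_rfl).symm (Pi.single i 1) := fun i => by
      obtain ⟨N, hN⟩ := hE.exists_extension hU f (X.basicOpen_le f) rfl
        ((c _ le_rfl).symm (Pi.single i 1))
      exact ⟨N, hN N le_rfl⟩
    choose N σ hσ using hex
    refine ⟨Submodule.span _ (Set.range σ), Submodule.fg_span (Set.finite_range σ), fun s => ?_⟩
    have hex2 : ∀ i, ∃ (n : ℕ) (b : Γ(X, U)),
        X.presheaf.map (homOfLE (X.basicOpen_le f)).op b =
          X.presheaf.map (homOfLE (X.basicOpen_le f)).op f ^ n *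
            c _ le_rfl (res E (X.basicOpen_le f) s) i := fun i => by
      have hloc := hU.isLocalization_basicOpen f
      obtain ⟨n, b, e⟩ := IsLocalization.Away.surj (S := Γ(X, X.basicOpen f)) f
        (c _ le_rfl (res E (X.basicOpen_le f) s) i)
      exact ⟨n, b, by rw [mul_comm]; exact e.symm⟩
    choose n b hb using hex2
    let K := ∑ i, (N i + n i)
    have hK : ∀ i, N i + n i ≤ K := fun i =>
      Finset.single_le_sum (f := fun i => N i + n i) (fun _ _ => Nat.zero_le _)
        (Finset.mem_univ i)
    refine ⟨K, ?_⟩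
    have key : f ^ K • s = ∑ i, (f ^ (K - (N i + n i)) * b i) • σ i := by
      apply hE.res_injective (X.basicOpen_le f) hfe
      rw [map_sum]
      conv_lhs => rw [res_smul, map_pow, ← hr (res E (X.basicOpen_le f) s), Finset.smul_sum]
      refine Finset.sum_congr rfl fun i _ => ?_
      rw [res_smul, hσ, map_mul, hb, map_pow, smul_smul, smul_smul]
      congr 1
      have : K = (K - (N i + n i)) + n i + N i := by have := hK i; omega
      conv_lhs => rw [this, pow_add, pow_add]
      ring
    rw [key]
    exact Submodule.sum_mem _ fun i _ => Submodule.smul_mem _ _ (Submodule.subset_span ⟨i, rfl⟩)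
  choose P hP hPs using loc
  refine ⟨?_⟩
  have : (⊤ : Submodule Γ(X, U) Γ(E, U)) = ⨆ f, P f := by
    refine (eq_top_iff.2 fun s _ => ?_).symm
    refine Submodule.mem_of_span_eq_top_of_smul_pow_mem _ (F : Set Γ(X, U)) hF s fun f => ?_
    obtain ⟨n, hn⟩ := hPs f s
    exact ⟨n, Submodule.mem_iSup_of_mem (p := P) f hn⟩
  rw [this]
  exact Submodule.fg_iSup P hP

end Restriction


/-! ### Spectral decomposition from a Bézout identity -/

section Decomposition

/-- Combine 1 = ∑ c_i ∏_{j ≠ i} u_j with 1 = α ∏ u_i + β q by multiplying the first identity by β q.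
With no indices the product is 1 and the coefficient b = 1 is enough. -/
theorem exists_partition_of_coprime {P : Type*} [CommRing P] {ι : Type*} [Fintype ι]
    [DecidableEq ι] (u : ι → P) (q : P) (hu : Pairwise (Function.onFun IsCoprime u))
    (hq : IsCoprime (∏ i, u i) q) :
    ∃ (a : ι → P) (b : P), ∑ i, a i * ((∏ j ∈ {i}ᶜ, u j) * q) + b * ∏ i, u i = 1 := by
  cases isEmpty_or_nonempty ι with
  | inl h => exact ⟨fun _ => 0, 1, by simp⟩
  | inr h =>
    obtain ⟨c, hc⟩ := exists_sum_eq_one_iff_pairwise_coprime'.2 hu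
    obtain ⟨α, β, h⟩ := hq
    refine ⟨fun i => β * c i, α, ?_⟩
    have : ∑ i, β * c i * ((∏ j ∈ {i}ᶜ, u j) * q) = β * q * ∑ i, c i * ∏ j ∈ {i}ᶜ, u j := by
      rw [Finset.mul_sum]
      exact Finset.sum_congr rfl fun i _ => by ring
    rw [this, hc, mul_one, add_comm, h]

/-- A partition of unity `1 = ∑ e i + e₀` into elements which behave like the projections to the
summands of `⨁ ker (g i) ⊕ im G`. -/
structure SpectralPartition {A : Type*} [Ring A] {ι : Type*} [Fintype ι] (g : ι → A) (G : A)
    where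
  e : ι → A
  e₀ : A
  sum_eq : ∑ i, e i + e₀ = 1
  mul_e : ∀ i, g i * e i = 0
  e_mul : ∀ i, e i * G = 0
  d : ι → ι → A
  e_eq : ∀ i j, i ≠ j → e j = d i j * g i
  d₀ : ι → A
  e₀_eq : ∀ i, e₀ = d₀ i * g i
  b : A
  e₀_eq' : e₀ = G * b

/-- Take e_i = a_i (∏_{j ≠ i} u_j) q and e₀ = b ∏ u_i. Multiplying e_i by u_i or by the full product
gives a multiple of (∏ u_i) q, which maps to 0; the other relations are divisibilities. Idempotence
is never needed. -/
theorem exists_spectralPartition {P A : Type*} [CommRing P] [Ring A] (θ : P →+* A) {ι : Type*}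
    [Fintype ι] [DecidableEq ι] (u : ι → P) (q : P)
    (hu : Pairwise (Function.onFun IsCoprime u)) (hq : IsCoprime (∏ i, u i) q)
    (h0 : θ ((∏ i, u i) * q) = 0) :
    Nonempty (SpectralPartition (fun i => θ (u i)) (θ (∏ i, u i))) := by
  obtain ⟨a, b, hab⟩ := exists_partition_of_coprime u q hu hq
  have hprod : ∀ i, (∏ j ∈ {i}ᶜ, u j) * u i = ∏ j, u j := fun i => by
    rw [← Finset.prod_compl_mul_prod {i} u, Finset.prod_singleton]
  have hz : ∀ p, θ (p * ((∏ i, u i) * q)) = 0 := fun p => by rw [map_mul, h0, mul_zero]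
  refine ⟨⟨fun i => θ (a i * ((∏ j ∈ {i}ᶜ, u j) * q)), θ (b * ∏ i, u i), ?_, fun i => ?_,
    fun i => ?_, fun i j => θ (a j * ((∏ l ∈ {j}ᶜ \ {i}, u l) * q)), fun i j hij => ?_,
    fun i => θ (b * ∏ j ∈ {i}ᶜ, u j), fun i => ?_, θ b, ?_⟩⟩
  · rw [← map_sum, ← map_add, hab, map_one]
  · rw [← map_mul, ← hz (a i), ← hprod i]
    congr 1
    ring
  · rw [← map_mul, ← hz (a i * ∏ j ∈ {i}ᶜ, u j)]
    congr 1
    ring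
  · rw [← map_mul, ← Finset.prod_sdiff (s₁ := {i}) (s₂ := {j}ᶜ) (by simpa [eq_comm] using hij),
      Finset.prod_singleton]
    congr 1
    ring
  · rw [← map_mul, mul_assoc, hprod]
  · rw [← map_mul, mul_comm]

namespace SpectralPartition

/-- The image of a partition of unity under a ring homomorphism. -/
def map {A B : Type*} [Ring A] [Ring B] {ι : Type*} [Fintype ι] {g : ι → A} {G : A}
    (p : SpectralPartition g G) (θ : A →+* B) : SpectralPartition (fun i => θ (g i)) (θ G) where
  e i := θ (p.e i)
  e₀ := θ p.e₀
  sum_eq := by rw [← map_sum, ← map_add, p.sum_eq, map_one]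
  mul_e i := by rw [← map_mul, p.mul_e, map_zero]
  e_mul i := by rw [← map_mul, p.e_mul, map_zero]
  d i j := θ (p.d i j)
  e_eq i j h := by rw [← map_mul, ← p.e_eq i j h]
  d₀ i := θ (p.d₀ i)
  e₀_eq i := by rw [← map_mul, ← p.e₀_eq i]
  b := θ p.b
  e₀_eq' := by rw [← map_mul, ← p.e₀_eq']

section Module

variable {S M : Type*} [CommRing S] [AddCommGroup M] [Module S M] {ι : Type*} [Fintype ι]
  {g : ι → Module.End S M} {G : Module.End S M} (p : SpectralPartition g G)

include p in
-- On ker g_i every e_j with j ≠ i and e₀ vanish, being left multiples of g_i, so only e_i is left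
-- of the partition of 1.
theorem apply_eq_self {i : ι} {m : M} (hm : g i m = 0) : p.e i m = m := by
  classical
  have h := LinearMap.congr_fun p.sum_eq m
  have h₀ : p.e₀ m = 0 := by rw [p.e₀_eq i, Module.End.mul_apply, hm, map_zero]
  rw [LinearMap.add_apply, h₀, add_zero, LinearMap.sum_apply, Finset.sum_eq_single i] at h
  · exact h
  · intro j _ hj
    rw [p.e_eq i j hj.symm, Module.End.mul_apply, hm, map_zero]
  · simp

theorem apply_apply_eq_zero (i : ι) (m : M) : g i (p.e i m) = 0 :=
  LinearMap.congr_fun (p.mul_e i) m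

theorem e₀_apply_apply (m : M) : p.e₀ (G m) = G m := by
  have h := LinearMap.congr_fun p.sum_eq (G m)
  rw [LinearMap.add_apply, LinearMap.sum_apply, Finset.sum_eq_zero, zero_add] at h
  · exact h
  · exact fun i _ => LinearMap.congr_fun (p.e_mul i) m

include p in
-- Each projection is the identity on its own summand and kills the others, which gives
-- independence. The partition of 1 shows that the summands span.
theorem isInternal [DecidableEq ι] : DirectSum.IsInternal (fun o : Option ι =>
    o.elim (LinearMap.range G) (fun i => LinearMap.ker (g i))) := by
  set N : Option ι → Submodule S M := fun o =>
    o.elim (LinearMap.range G) (fun i => LinearMap.ker (g i)) with hN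
  let P : Option ι → Module.End S M := fun o => o.elim p.e₀ p.e
  have h1 : ∀ o, ∀ m ∈ N o, P o m = m := by
    rintro (_ | i) m hm
    · obtain ⟨m, rfl⟩ := hm
      exact p.e₀_apply_apply m
    · exact p.apply_eq_self hm
  have h2 : ∀ o o', o ≠ o' → N o' ≤ LinearMap.ker (P o) := by
    rintro (_ | i) (_ | j) h m hm
    · exact (h rfl).elim
    · change p.e₀ m = 0
      rw [p.e₀_eq j, Module.End.mul_apply, LinearMap.mem_ker.1 hm, map_zero]
    · obtain ⟨m, rfl⟩ := hm
      exact LinearMap.congr_fun (p.e_mul i) m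
    · change p.e i m = 0
      rw [p.e_eq j i fun e => h (by rw [e]), Module.End.mul_apply, LinearMap.mem_ker.1 hm,
        map_zero]
  refine DirectSum.isInternal_submodule_of_iSupIndep_of_iSup_eq_top ?_ ?_
  · intro o
    rw [Submodule.disjoint_def]
    intro m hm hm'
    rw [← h1 o m hm]
    exact (iSup₂_le fun o' ho' => h2 o o' ho'.symm :
      (⨆ (o') (_ : o' ≠ o), N o') ≤ LinearMap.ker (P o)) hm'
  · refine eq_top_iff.2 fun m _ => ?_
    have h := LinearMap.congr_fun p.sum_eq m
    rw [LinearMap.add_apply, LinearMap.sum_apply] at h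
    rw [← show _ = m from h]
    refine Submodule.add_mem _ (Submodule.sum_mem _ fun i _ => ?_) ?_
    · exact Submodule.mem_iSup_of_mem (some i) (p.apply_apply_eq_zero i m)
    · refine Submodule.mem_iSup_of_mem none ?_
      rw [p.e₀_eq']
      exact ⟨p.b m, rfl⟩

end Module

section Category

variable {C : Type*} [Category* C] [Abelian C] [HasFiniteBiproducts C] {E : C} {ι : Type}
  [Fintype ι] [DecidableEq ι] {g : ι → End E} {G : End E} (p : SpectralPartition g G)

omit [HasFiniteBiproducts C] [DecidableEq ι] in
include p in
-- Multiplication in `End E` is composition in reverse order, so the left multiples of g_i are the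
-- arrows that start with g_i and vanish on its kernel. Relations on the image of G are tested after
-- the epimorphism onto it.
theorem exists_comp_eq : ∃ (e : ι → (E ⟶ E)) (e₀ b : E ⟶ E), e = p.e ∧ e₀ = p.e₀ ∧
    ∑ i, e i + e₀ = 𝟙 E ∧ (∀ i, e i ≫ g i = 0) ∧ (∀ i, G ≫ e i = 0) ∧
    (∀ i, kernel.ι (g i) ≫ e₀ = 0) ∧ (∀ i j, i ≠ j → kernel.ι (g i) ≫ e j = 0) ∧
    b ≫ G = e₀ ∧ (∀ i, kernel.ι (g i) ≫ e i = kernel.ι (g i)) ∧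
    (∀ i, image.ι G ≫ e i = 0) ∧ image.ι G ≫ e₀ = image.ι G := by
  obtain ⟨e, e₀, b, he, he₀, hsum, hge, heG, hk, hk', hb⟩ : ∃ (e : ι → (E ⟶ E)) (e₀ b : E ⟶ E),
      e = p.e ∧ e₀ = p.e₀ ∧
      ∑ i, e i + e₀ = 𝟙 E ∧ (∀ i, e i ≫ g i = 0) ∧ (∀ i, G ≫ e i = 0) ∧
      (∀ i, kernel.ι (g i) ≫ e₀ = 0) ∧ (∀ i j, i ≠ j → kernel.ι (g i) ≫ e j = 0) ∧
      b ≫ G = e₀ := by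
    refine ⟨p.e, p.e₀, p.b, rfl, rfl, p.sum_eq, p.mul_e, p.e_mul, fun i => ?_, fun i j h => ?_,
      p.e₀_eq'.symm⟩
    · rw [p.e₀_eq i, End.mul_def, kernel.condition_assoc, zero_comp]
    · rw [p.e_eq i j h, End.mul_def, kernel.condition_assoc, zero_comp]
  have hki : ∀ i, kernel.ι (g i) ≫ e i = kernel.ι (g i) := fun i => by
    have h := congrArg (kernel.ι (g i) ≫ ·) hsum
    simp only [Preadditive.comp_add, hk, add_zero, Preadditive.comp_sum, Category.comp_id] at h
    rwa [Finset.sum_eq_single i (fun j _ hj => hk' i j hj.symm) (by simp)] at h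
  have hGe : ∀ i, image.ι G ≫ e i = 0 := fun i => by
    rw [← cancel_epi (factorThruImage G), image.fac_assoc, comp_zero, heG]
  have hG : image.ι G ≫ e₀ = image.ι G := by
    have h := congrArg (image.ι G ≫ ·) hsum
    simpa only [Preadditive.comp_add, Preadditive.comp_sum, hGe, Finset.sum_const_zero, zero_add,
      Category.comp_id] using h
  exact ⟨e, e₀, b, he, he₀, hsum, hge, heG, hk, hk', hb, hki, hGe, hG⟩

omit [HasFiniteBiproducts C] [DecidableEq ι] in
theorem kernel_fac (i : ι) : ∃ l : E ⟶ kernel (g i), l ≫ kernel.ι (g i) = p.e i ∧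
    kernel.ι (g i) ≫ p.e i = kernel.ι (g i) := by
  obtain ⟨e, e₀, b, he, he₀, hsum, hge, heG, hk, hk', hb, hki, hGe, hG⟩ := p.exists_comp_eq
  rw [← he]
  exact ⟨kernel.lift _ _ (hge i), kernel.lift_ι _ _ _, hki i⟩

omit [HasFiniteBiproducts C] [DecidableEq ι] in
theorem image_fac : ∃ l : E ⟶ image G, l ≫ image.ι G = p.e₀ ∧
    image.ι G ≫ p.e₀ = image.ι G := by
  obtain ⟨e, e₀, b, he, he₀, hsum, hge, heG, hk, hk', hb, hki, hGe, hG⟩ := p.exists_comp_eq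
  rw [← he₀]
  exact ⟨b ≫ factorThruImage G, by rw [Category.assoc, image.fac, hb], hG⟩

include p in
theorem isIso_desc :
    IsIso (biprod.desc (biproduct.desc fun i => kernel.ι (g i)) (image.ι G)) := by
  obtain ⟨e, e₀, b, -, -, hsum, hge, heG, hk, hk', hb, hki, hGe, hG⟩ := p.exists_comp_eq
  have hbi : b ≫ factorThruImage G ≫ image.ι G = e₀ := by rw [image.fac, hb]
  -- The inverse has as components the e_i, lifted to the kernels, and e₀ = b ≫ G, factored through
  -- the image.
  refine ⟨biprod.lift (biproduct.lift fun i => kernel.lift (g i) (e i) (hge i))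
    (b ≫ factorThruImage G), ?_, ?_⟩
  · apply biprod.hom_ext' <;> apply biprod.hom_ext
    · ext i j
      by_cases hij : i = j
      · subst hij
        simp [hki]
      · simp [hk' j i (Ne.symm hij), biproduct.ι_π_ne_assoc _ (Ne.symm hij)]
    · ext i
      rw [← cancel_mono (image.ι G)]
      simp only [biprod.inl_desc_assoc, biproduct.ι_desc_assoc, Category.assoc, biprod.lift_snd,
        Category.comp_id, biprod.inl_snd, comp_zero, zero_comp, hbi, hk]
    · ext i
      simp only [biprod.inr_desc_assoc, Category.assoc, biprod.lift_fst, biproduct.lift_π,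
        kernel.lift_ι, Category.comp_id, biprod.inr_fst, zero_comp, hGe]
    · rw [← cancel_mono (image.ι G)]
      simp only [biprod.inr_desc_assoc, Category.assoc, biprod.lift_snd, hbi, hG,
        Category.comp_id, biprod.inr_snd, Category.id_comp]
  · rw [biprod.lift_desc, Category.assoc, hbi, biproduct.lift_desc]
    simpa using hsum

end Category

end SpectralPartition

end Decomposition

/-! ### Cayley–Hamilton with coefficients in the base field -/

section CayleyHamilton

open Polynomial

variable {k S M : Type*} [Field k] [CommRing S] [Algebra k S] [AddCommGroup M] [Module S M]
  [Module k M] [IsScalarTower k S M]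

theorem represents_aeval {ι : Type*} [Fintype ι] [DecidableEq ι] {b : ι → M} {a : Matrix ι ι S}
    {f : Module.End S M} (h : a.Represents b f) (p : S[X]) :
    (aeval a p).Represents b (aeval f p) := by
  induction p using Polynomial.induction_on' with
  | add p q hp hq => rw [map_add, map_add]; exact hp.add hq
  | monomial n r =>
    rw [aeval_monomial, aeval_monomial]
    refine (Matrix.Represents.algebraMap r).mul ?_
    induction n with
    | zero => simpa using Matrix.Represents.one
    | succ n ih => rw [pow_succ, pow_succ]; exact ih.mul h

/-- A form of the Cayley–Hamilton theorem with coefficients in the base field. -/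
theorem aeval_charpoly_mapQ (ε : S →ₐ[k] k) (I : Ideal S) (hI : ∀ s, ε s = 0 ↔ s ∈ I)
    [Module.Finite S M] (φ : Module.End S M)
    (hφ : ∀ Q : S[X], aeval φ Q = 0 →
      aeval (φ.restrictScalars k) (Q.map (ε : S →+* k)) = 0)
    (h : (I • ⊤ : Submodule S M) ≤ (I • ⊤ : Submodule S M).comap φ)
    [Module.Finite k (M ⧸ (I • ⊤ : Submodule S M))] :
    aeval (φ.restrictScalars k)
      (LinearMap.charpoly (((I • ⊤ : Submodule S M).mapQ _ φ h).restrictScalars k)) = 0 := by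
  classical
  set A := ((I • ⊤ : Submodule S M).mapQ _ φ h).restrictScalars k with hA
  let b := Module.finBasis k (M ⧸ (I • ⊤ : Submodule S M))
  choose e he using fun i => Submodule.mkQ_surjective _ (b i)
  have hsmul : ∀ (s : S) (v : M ⧸ (I • ⊤ : Submodule S M)), s • v = ε s • v := by
    intro s v
    obtain ⟨m, rfl⟩ := Submodule.mkQ_surjective _ v
    rw [← algebraMap_smul S (ε s), ← sub_eq_zero, ← sub_smul, ← map_smul, ← LinearMap.mem_ker,
      Submodule.ker_mkQ]
    exact Submodule.smul_mem_smul ((hI _).1 (by simp)) trivial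
  let P := Submodule.span S (Set.range e)
  have hP : (⊤ : Submodule S M) ≤ P ⊔ I • ⊤ := by
    intro m _
    have h1 : m - ∑ i, algebraMap k S (b.repr (Submodule.mkQ _ m) i) • e i ∈
        (I • ⊤ : Submodule S M) := by
      refine (Submodule.Quotient.mk_eq_zero _).1 (?_ : Submodule.mkQ _ _ = 0)
      rw [map_sub, map_sum, sub_eq_zero]
      simp only [algebraMap_smul, LinearMap.map_smul_of_tower, he]
      exact (b.sum_repr _).symm
    rw [← sub_add_cancel m (∑ i, algebraMap k S (b.repr (Submodule.mkQ _ m) i) • e i), add_comm]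
    exact Submodule.add_mem_sup (Submodule.sum_mem _ fun i _ =>
      Submodule.smul_mem _ _ (Submodule.subset_span ⟨i, rfl⟩)) h1
  -- Nakayama for M/P: there is no local ring, so M is only pushed into P by some s ≡ 1 mod I.
  obtain ⟨s, hs, hsP⟩ : ∃ s : S, ε s = 1 ∧ ∀ m : M, s • m ∈ P := by
    obtain ⟨s, hs, hs'⟩ := Submodule.exists_sub_one_mem_and_smul_eq_zero_of_fg_of_le_smul I
      (⊤ : Submodule S (M ⧸ P)) Module.Finite.fg_top (by
        have := Submodule.map_mono (f := P.mkQ) hP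
        rw [Submodule.map_sup, Submodule.map_smul'', Submodule.map_top, Submodule.range_mkQ,
          Submodule.mkQ_map_self, bot_sup_eq] at this
        exact this)
    refine ⟨s, ?_, fun m => ?_⟩
    · have := (hI _).2 hs
      rwa [map_sub, map_one, sub_eq_zero] at this
    · rw [← Submodule.Quotient.mk_eq_zero, Submodule.Quotient.mk_smul]
      exact hs' _ trivial
  have hcoef : ∀ j, ∃ c : Fin _ → S, ∑ i, c i • e i = s • φ (e j) := fun j =>
    (Submodule.mem_span_range_iff_exists_fun S).1 (hsP _)
  choose c hc using hcoef
  let a : Matrix (Fin (Module.finrank k (M ⧸ (I • ⊤ : Submodule S M)))) _ S :=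
    Matrix.of fun i j => c j i
  have hrep : a.Represents e (s • φ) := Matrix.represents_iff'.2 fun j => hc j
  have hker : ∀ i, aeval (s • φ) a.charpoly (e i) = 0 := fun i => by
    have h1 := represents_aeval hrep a.charpoly
    rw [Matrix.aeval_self_charpoly] at h1
    have := Matrix.represents_iff'.1 h1 i
    simpa using this.symm
  have hker' : ∀ m ∈ P, aeval (s • φ) a.charpoly m = 0 := fun m hm => by
    have : P ≤ LinearMap.ker (aeval (s • φ) a.charpoly) := by
      rw [Submodule.span_le]
      rintro _ ⟨i, rfl⟩
      exact hker i
    exact this hm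
  -- The right-hand factor s moves m into P, where the characteristic polynomial of a, evaluated at
  -- sφ, vanishes.
  have hQ : aeval φ (a.charpoly.comp (C s * X) * C s) = 0 := by
    ext m
    rw [map_mul, aeval_comp, map_mul, aeval_C, aeval_X, Module.End.mul_apply,
      Module.algebraMap_end_apply, LinearMap.zero_apply, ← hker' _ (hsP m)]
    congr 3
  have hfin := hφ _ hQ
  rw [Polynomial.map_mul, Polynomial.map_comp, Polynomial.map_mul, map_C, map_X] at hfin
  have hs' : (ε : S →+* k) s = 1 := hs
  rw [hs', C_1, one_mul, mul_one, comp_X, ← Matrix.charpoly_map] at hfin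
  -- Modulo I, s becomes 1 and a becomes the matrix of the induced map, so the reduction of the
  -- annihilating polynomial is the characteristic polynomial of A.
  have hmat : a.map (ε : S →+* k) = LinearMap.toMatrix b b A := by
    ext i j
    rw [LinearMap.toMatrix_apply]
    have h1 : A (b j) = ∑ i, ε (a i j) • b i := by
      have h2 : A (b j) = Submodule.mkQ _ (φ (e j)) := by rw [← he]; rfl
      have h3 : Submodule.mkQ (I • ⊤ : Submodule S M) (s • φ (e j)) =
        Submodule.mkQ _ (φ (e j)) := by rw [map_smul, hsmul, hs, one_smul]
      rw [h2, ← h3, ← hc, map_sum]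
      exact Finset.sum_congr rfl fun i _ => by rw [map_smul, hsmul, he]; rfl
    rw [h1, map_sum, Finset.sum_apply']
    simp [Finsupp.single_apply]
  rw [hmat, LinearMap.charpoly_toMatrix] at hfin
  exact hfin

end CayleyHamilton

/-! ### Splitting off prescribed roots of a polynomial -/

section Multiplicity

open Polynomial

theorem pairwise_isCoprime_pow {k ι : Type*} [Field k] {c : ι → k} (hc : Function.Injective c)
    (m : ι → ℕ) : Pairwise (Function.onFun IsCoprime fun i => (X - C (c i)) ^ m i) :=
  fun _ _ h => ((pairwise_coprime_X_sub_C hc) h).pow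

/-- Were some X - c_i to divide the cofactor, p would be divisible by it once more than its
multiplicity allows. -/
theorem exists_eq_prod_mul_coprime {k ι : Type*} [Field k] [Fintype ι] {c : ι → k}
    (hc : Function.Injective c) {p : k[X]} (hp : p ≠ 0) :
    ∃ q, p = (∏ i, (X - C (c i)) ^ p.rootMultiplicity (c i)) * q ∧
      IsCoprime (∏ i, (X - C (c i)) ^ p.rootMultiplicity (c i)) q := by
  obtain ⟨q, hq⟩ : ∏ i, (X - C (c i)) ^ p.rootMultiplicity (c i) ∣ p :=
    Fintype.prod_dvd_of_coprime (pairwise_isCoprime_pow hc _) fun i =>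
      pow_rootMultiplicity_dvd p (c i)
  refine ⟨q, hq, IsCoprime.prod_left fun i _ => IsCoprime.pow_left ?_⟩
  refine (irreducible_X_sub_C (c i)).coprime_iff_not_dvd.2 fun h => ?_
  refine pow_rootMultiplicity_not_dvd hp (c i) ?_
  conv_rhs => rw [hq]
  rw [pow_succ]
  exact mul_dvd_mul (Finset.dvd_prod_of_mem (fun i => (X - C (c i)) ^ p.rootMultiplicity (c i))
    (Finset.mem_univ i)) h

end Multiplicity


/-! ### Finite generation by saturation in height two -/

section FiniteGeneration

/-- Over a Noetherian domain `A`, every torsion-free module contained in the saturation of a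
finitely generated one with respect to two coprime elements is finitely generated. -/
theorem finite_of_saturation {A M : Type*} [CommRing A] [IsDomain A] [IsNoetherianRing A]
    [AddCommGroup M] [Module A M] (htf : ∀ (a : A) (m : M), a • m = 0 → a = 0 ∨ m = 0)
    {y z : A} (hy : Prime y) (hyz : ¬ y ∣ z) (P : Submodule A M) (hP : P.FG)
    (hM : ∀ m : M, (∃ n, y ^ n • m ∈ P) ∧ ∃ n, z ^ n • m ∈ P) : Module.Finite A M := by
  classical
  obtain ⟨T, hT⟩ := hP
  -- A maximal independent set of generators spans a free F, and every generator has a nonzero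
  -- multiple in F. The product a of these multipliers carries P into F.
  obtain ⟨s, hs, hs'⟩ := exists_maximal_linearIndepOn A (fun t : T => t.1)
  have hsc : ∀ t : T, ∃ a : A, a ≠ 0 ∧ a • t.1 ∈ Submodule.span A ((fun t : T => t.1) '' s) := by
    intro t
    by_cases ht : t ∈ s
    · exact ⟨1, one_ne_zero, by rw [one_smul]; exact Submodule.subset_span ⟨t, ht, rfl⟩⟩
    · exact hs' t ht
  choose a ha hat using hsc
  set F := Submodule.span A ((fun t : T => t.1) '' s) with hF
  have hPF : ∀ m ∈ P, (∏ t, a t) • m ∈ F := by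
    intro m hm
    rw [← hT] at hm
    induction hm using Submodule.span_induction with
    | mem x hx =>
      rw [← Finset.prod_erase_mul _ a (Finset.mem_univ (⟨x, hx⟩ : T)), mul_smul]
      exact F.smul_mem _ (hat ⟨x, hx⟩)
    | zero => rw [smul_zero]; exact F.zero_mem
    | add x y _ _ hx hy => rw [smul_add]; exact F.add_mem hx hy
    | smul c x _ hx => rw [smul_comm]; exact F.smul_mem _ hx
  have hFr : F = Submodule.span A (Set.range fun t : s => t.1.1) := by
    rw [hF, Set.image_eq_range]
  have hz : ∀ n : ℕ, ¬ y ∣ z ^ n := fun n h => hyz (hy.dvd_of_dvd_pow h)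
  have hall : ∀ m, (∏ t, a t) • m ∈ F := by
    intro m
    obtain ⟨⟨n₁, h₁⟩, n₂, h₂⟩ := hM m
    have h₁' := hPF _ h₁
    have h₂' := hPF _ h₂
    rw [hFr, Submodule.mem_span_range_iff_exists_fun] at h₁' h₂' ⊢
    obtain ⟨c, hc⟩ := h₁'
    obtain ⟨d, hd⟩ := h₂'
    -- In the basis of F, a y^{n₁} m has coordinates c and a z^{n₂} m has coordinates d. Since y is
    -- prime to z, y^{n₁} divides each c_i; cancelling it, by torsion-freeness, puts a m in F.
    have heq : ∀ i, z ^ n₂ * c i = y ^ n₁ * d i := by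
      refine hs.eq_coords_of_eq ?_
      simp only [mul_smul, ← Finset.smul_sum]
      rw [hc, hd]
      simp only [smul_smul]
      congr 1
      ring
    have hdvd : ∀ i, y ^ n₁ ∣ c i := fun i =>
      hy.pow_dvd_of_dvd_mul_left n₁ (hz n₂) ⟨d i, heq i⟩
    choose c' hc' using hdvd
    refine ⟨c', ?_⟩
    have : y ^ n₁ • (∑ i, c' i • i.1.1 - (∏ t, a t) • m) = 0 := by
      rw [smul_sub, smul_comm, ← hc, Finset.smul_sum, sub_eq_zero]
      exact Finset.sum_congr rfl fun i _ => by rw [hc' i, mul_smul]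
    exact sub_eq_zero.1 ((htf _ _ this).resolve_left (pow_ne_zero _ hy.ne_zero))
  have hFfin : Module.Finite A F :=
    Module.Finite.iff_fg.2 (Submodule.fg_span (s.toFinite.image _))
  let L : M →ₗ[A] F :=
    { toFun := fun m => ⟨(∏ t, a t) • m, hall m⟩
      map_add' := fun m m' => Subtype.ext (smul_add _ _ _)
      map_smul' := fun c m => Subtype.ext (smul_comm _ _ _) }
  -- Multiplication by a embeds M in the Noetherian module F.
  refine Module.Finite.of_injective L ((injective_iff_map_eq_zero L).2 fun m hm => ?_)
  exact (htf _ _ (congrArg Subtype.val hm)).resolve_left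
    (Finset.prod_ne_zero_iff.2 fun t _ => ha t)

/-- Noether normalization with the variables in a given rational maximal ideal. -/
theorem exists_finite_inj_algHom_mem {k R : Type*} [Field k] [CommRing R] [Nontrivial R]
    [Algebra k R] [Algebra.FiniteType k R] (𝔪 : Ideal R)
    (h𝔪 : ∀ r : R, ∃ c : k, r - algebraMap k R c ∈ 𝔪) :
    ∃ (s : ℕ) (g : MvPolynomial (Fin s) k →ₐ[k] R), Function.Injective g ∧ g.Finite ∧
      ∀ i, g (MvPolynomial.X i) ∈ 𝔪 := by
  obtain ⟨s, g, hg, hg'⟩ := exists_finite_inj_algHom_of_fg k R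
  -- Rationality of 𝔪 lets each variable be translated by a constant so that its image lands in 𝔪.
  choose c hc using fun i => h𝔪 (g (MvPolynomial.X i))
  let τ : MvPolynomial (Fin s) k →ₐ[k] MvPolynomial (Fin s) k :=
    MvPolynomial.aeval fun i => MvPolynomial.X i - MvPolynomial.C (c i)
  let σ : MvPolynomial (Fin s) k →ₐ[k] MvPolynomial (Fin s) k :=
    MvPolynomial.aeval fun i => MvPolynomial.X i + MvPolynomial.C (c i)
  have hστ : σ.comp τ = AlgHom.id k _ := by
    ext1 i
    simp [σ, τ, ← MvPolynomial.algebraMap_eq]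
  have hτσ : τ.comp σ = AlgHom.id k _ := by
    ext1 i
    simp [σ, τ, ← MvPolynomial.algebraMap_eq]
  have hinj : Function.Injective τ :=
    Function.LeftInverse.injective (g := σ) fun p => AlgHom.congr_fun hστ p
  have hsurj : Function.Surjective τ :=
    Function.RightInverse.surjective (g := σ) fun p => AlgHom.congr_fun hτσ p
  refine ⟨s, g.comp τ, hg.comp hinj, hg'.comp (AlgHom.Finite.of_surjective τ hsurj), fun i => ?_⟩
  simpa [τ, ← MvPolynomial.algebraMap_eq] using hc i

/-- A torsion-free module over a finitely generated domain over a field is finitely generated if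
it lies in the saturation of a finitely generated submodule with respect to a rational maximal
ideal of height at least two. -/
theorem finite_of_saturation_maximal {k R M : Type*} [Field k] [CommRing R] [IsDomain R]
    [Algebra k R] [Algebra.FiniteType k R] [AddCommGroup M] [Module R M]
    (htf : ∀ (r : R) (m : M), r • m = 0 → r = 0 ∨ m = 0)
    (𝔪 : Ideal R) (h𝔪 : ∀ r : R, ∃ c : k, r - algebraMap k R c ∈ 𝔪) (h𝔪' : 𝔪 ≠ ⊤)
    (q : Ideal R) [q.IsPrime] (hq : q ≠ ⊥) (hq𝔪 : q < 𝔪)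
    (P : Submodule R M) (hP : P.FG) (hM : ∀ m : M, ∀ x ∈ 𝔪, ∃ n, x ^ n • m ∈ P) :
    Module.Finite R M := by
  obtain ⟨s, g, hg, hg', hgm⟩ := exists_finite_inj_algHom_mem 𝔪 h𝔪
  algebraize [g.toRingHom]
  have hfin : Module.Finite (MvPolynomial (Fin s) k) R := hg'
  let : Module (MvPolynomial (Fin s) k) M := Module.compHom M g.toRingHom
  have : IsScalarTower (MvPolynomial (Fin s) k) R M :=
    ⟨fun a r m => by
      rw [Algebra.smul_def, mul_smul]
      rfl⟩
  -- With at most one variable the nonzero contraction of q would be maximal, hence q itself by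
  -- integrality, contradicting q < 𝔪 ≠ ⊤.
  have hs : 2 ≤ s := by
    by_contra! hs
    have : Ring.KrullDimLE 1 (MvPolynomial (Fin s) k) := by
      rw [Ring.krullDimLE_iff, MvPolynomial.ringKrullDim_of_isNoetherianRing,
        ringKrullDim_eq_zero_of_field, zero_add, Nat.card_fin]
      exact_mod_cast Nat.le_of_lt_succ hs
    obtain ⟨x, hxq, hx⟩ := Submodule.exists_mem_ne_zero_of_ne_bot hq
    have h1 := Ring.krullDimLE_one_iff_of_noZeroDivisors.1 this
      (q.comap (algebraMap (MvPolynomial (Fin s) k) R))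
      (Ideal.comap_ne_bot_of_integral_mem hx hxq (Algebra.IsIntegral.isIntegral x)) inferInstance
    have := Ideal.isMaximal_of_isIntegral_of_isMaximal_comap q h1
    exact h𝔪' (this.1.2 _ hq𝔪)
  have hPfin : (P.restrictScalars (MvPolynomial (Fin s) k)).FG := by
    exact hP.restrictScalars
  have hsmul : ∀ (a : MvPolynomial (Fin s) k) (m : M), a • m = g a • m := fun _ _ => rfl
  have : Module.Finite (MvPolynomial (Fin s) k) M := by
    refine finite_of_saturation (fun a m h => ?_)
      (MvPolynomial.X_prime (i := (⟨0, by omega⟩ : Fin s)))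
      (z := MvPolynomial.X ⟨1, by omega⟩) ?_ _ hPfin fun m => ⟨?_, ?_⟩
    · exact (htf _ _ h).imp_left fun h => (map_eq_zero_iff g hg).1 h
    · rw [MvPolynomial.X_dvd_X]
      simp
    · obtain ⟨n, hn⟩ := hM m _ (hgm ⟨0, by omega⟩)
      exact ⟨n, by rw [hsmul, map_pow]; exact hn⟩
    · obtain ⟨n, hn⟩ := hM m _ (hgm ⟨1, by omega⟩)
      exact ⟨n, by rw [hsmul, map_pow]; exact hn⟩
  exact Module.Finite.of_restrictScalars_finite (MvPolynomial (Fin s) k) R M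

end FiniteGeneration


/-! ### Dehomogenization on the standard charts -/

/-- The composite Spec of the degree-zero localization → ℙⁿ → Spec S_0 is induced by the inclusion
of degree zero; compare global sections. -/
theorem projConst_res (k : Type u) [Field k] (n : ℕ) (j : Fin (n + 1)) (c : k) :
    (projSpace k n).presheaf.map
      (homOfLE (le_top : Proj.basicOpen (coordGrading k n) (MvPolynomial.X j) ≤ ⊤)).op
        (projConst k n c) =
    (Proj.awayToSection (coordGrading k n) (MvPolynomial.X j)).hom
      (HomogeneousLocalization.fromZeroRingHom (coordGrading k n) _
        (algebraMap k (coordGrading k n 0) c)) := by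
  have h := Proj.awayι_toSpecZero (coordGrading k n) _ (X_mem k n j) one_pos
  rw [Proj.awayι, Category.assoc, Iso.inv_comp_eq, Proj.basicOpenIsoSpec_hom] at h
  have h2 := congrArg Scheme.Hom.appTop h
  rw [Scheme.Hom.comp_appTop, Scheme.Hom.comp_appTop] at h2
  have h3 := Proj.basicOpenToSpec_app_top (coordGrading k n) (MvPolynomial.X j)
  rw [Scheme.Hom.appTop, Scheme.Hom.appTop, Scheme.Hom.appTop, Scheme.Hom.appTop, h3,
    Scheme.Opens.ι_app] at h2
  have nat := Scheme.ΓSpecIso_naturality (CommRingCat.ofHom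
    (HomogeneousLocalization.fromZeroRingHom (coordGrading k n)
      (Submonoid.powers (MvPolynomial.X j))))
  let x := (Scheme.ΓSpecIso (.of (coordGrading k n 0))).inv
    (algebraMap k (coordGrading k n 0) c)
  have hx : (Scheme.ΓSpecIso (.of (coordGrading k n 0))).hom x =
      algebraMap k (coordGrading k n 0) c :=
    congr($((Scheme.ΓSpecIso (.of (coordGrading k n 0))).inv_hom_id) _)
  have h4 := congr((Proj.basicOpen (coordGrading k n) (MvPolynomial.X j)).topIso.hom ($h2 x))
  have h5 := congr($((Proj.basicOpen (coordGrading k n) (MvPolynomial.X j)).topIso.inv_hom_id)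
    (Proj.awayToSection (coordGrading k n) (MvPolynomial.X j)
      (HomogeneousLocalization.fromZeroRingHom (coordGrading k n) _
        ((Scheme.ΓSpecIso (.of (coordGrading k n 0))).hom x))))
  rw [← hx]
  refine Eq.trans ?_ (Eq.trans (h4.trans (congrArg (fun z =>
    (Proj.basicOpen (coordGrading k n) (MvPolynomial.X j)).topIso.hom
      ((Proj.basicOpen (coordGrading k n) (MvPolynomial.X j)).topIso.inv
        (Proj.awayToSection (coordGrading k n) (MvPolynomial.X j) z))) congr($nat x))) h5)
  exact (fun_res_res _ _ _).symm


/-- A monomial of degree N picks up the factor u exactly N times. Here u is T for the graded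
substitution and x_j in the localization. -/
theorem eval_homogeneous {k σ L : Type*} [CommSemiring k] [CommSemiring L]
    (F F' : MvPolynomial σ k →+* L) (u : L)
    (hC : ∀ c, F (MvPolynomial.C c) = F' (MvPolynomial.C c))
    (hX : ∀ l, F (MvPolynomial.X l) = F' (MvPolynomial.X l) * u)
    {q : MvPolynomial σ k} {N : ℕ} (hq : q.IsHomogeneous N) : F q = F' q * u ^ N := by
  rw [← q.support_sum_monomial_coeff, map_sum, map_sum, Finset.sum_mul]
  refine Finset.sum_congr rfl fun v hv => ?_
  have hdeg : v.degree = N := by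
    rw [← hq (MvPolynomial.mem_support_iff.1 hv), Finsupp.degree_eq_weight_one]
    rfl
  rw [MvPolynomial.monomial_eq, map_mul, map_mul, hC, mul_assoc]
  congr 1
  simp only [Finsupp.prod, map_prod, map_pow, hX, mul_pow, Finset.prod_mul_distrib]
  rw [Finset.prod_pow_eq_pow_sum, ← hdeg]
  rfl

section Charts

variable {k : Type u} [Field k] {n : ℕ} {X : Scheme.{u}} (ι : X ⟶ projSpace k n)

/-- Dehomogenization: the substitution `x_l ↦ x_l / x_j`. -/
def chartEval (j : Fin (n + 1)) : MvPolynomial (Fin (n + 1)) k →+* Γ(X, chart ι j) :=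
  MvPolynomial.eval₂Hom (constOn ι (chart ι j)) (ratio ι j)

/-- The substitution `x_l ↦ (x_l / x_j) T`. -/
def gradedEval (j : Fin (n + 1)) :
    MvPolynomial (Fin (n + 1)) k →+* Polynomial Γ(X, chart ι j) :=
  MvPolynomial.eval₂Hom (Polynomial.C.comp (constOn ι (chart ι j)))
    fun l => Polynomial.C (ratio ι j l) * Polynomial.X

theorem gradedEval_C (j : Fin (n + 1)) (c : k) :
    gradedEval ι j (MvPolynomial.C c) = Polynomial.C (constOn ι (chart ι j) c) := by
  simp [gradedEval]

theorem gradedEval_X (j l : Fin (n + 1)) :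
    gradedEval ι j (MvPolynomial.X l) = Polynomial.C (ratio ι j l) * Polynomial.X := by
  simp [gradedEval]

theorem gradedEval_X_self (j : Fin (n + 1)) :
    gradedEval ι j (MvPolynomial.X j) = Polynomial.X := by
  rw [gradedEval_X, ratio_self, map_one, one_mul]

theorem gradedEval_of_isHomogeneous (j : Fin (n + 1)) {q : MvPolynomial (Fin (n + 1)) k} {N : ℕ}
    (hq : q.IsHomogeneous N) :
    gradedEval ι j q = Polynomial.C (chartEval ι j q) * Polynomial.X ^ N :=
  eval_homogeneous (gradedEval ι j) (Polynomial.C.comp (chartEval ι j)) _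
    (fun c => by simp [gradedEval, chartEval]) (fun l => by simp [gradedEval, chartEval]) hq

theorem app_const (j : Fin (n + 1)) (c : k) :
    ι.app (Proj.basicOpen (coordGrading k n) (MvPolynomial.X j))
      (Proj.awayToSection (coordGrading k n) (MvPolynomial.X j)
        (HomogeneousLocalization.fromZeroRingHom (coordGrading k n) _
          (algebraMap k (coordGrading k n 0) c))) = constOn ι (chart ι j) c :=
  (congrArg _ (projConst_res k n j c)).symm.trans
    congr($(ι.naturality (homOfLE (le_top :
      Proj.basicOpen (coordGrading k n) (MvPolynomial.X j) ≤ ⊤)).op) (projConst k n c))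

/-- Dehomogenizing into the degree-zero localization and then passing to X agrees with `chartEval`
on constants and variables. On a form of degree N the first step gives q / x_j^N. -/
theorem app_awayToSection_mk (j : Fin (n + 1)) (N : ℕ) (q : MvPolynomial (Fin (n + 1)) k)
    (hq : q ∈ coordGrading k n (N • 1)) :
    ι.app (Proj.basicOpen (coordGrading k n) (MvPolynomial.X j))
      (Proj.awayToSection (coordGrading k n) (MvPolynomial.X j)
        (HomogeneousLocalization.Away.mk (coordGrading k n) (X_mem k n j) N q hq)) =
      chartEval ι j q := by
  let ψ : MvPolynomial (Fin (n + 1)) k →+*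
      HomogeneousLocalization.Away (coordGrading k n) (MvPolynomial.X j) :=
    MvPolynomial.eval₂Hom ((HomogeneousLocalization.fromZeroRingHom (coordGrading k n) _).comp
      (algebraMap k (coordGrading k n 0))) fun l =>
        HomogeneousLocalization.Away.mk (coordGrading k n) (X_mem k n j) 1 (MvPolynomial.X l)
          (by simpa using X_mem k n l)
  have h1 : ((ι.app (Proj.basicOpen (coordGrading k n) (MvPolynomial.X j))).hom.comp
      (Proj.awayToSection (coordGrading k n) (MvPolynomial.X j)).hom).comp ψ = chartEval ι j := by
    refine MvPolynomial.ringHom_ext (fun c => ?_) fun l => ?_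
    · refine Eq.trans ?_ ((app_const ι j c).trans ?_)
      · simp [ψ]
      · simp [chartEval]
    · simp only [RingHom.comp_apply, ψ, chartEval, MvPolynomial.coe_eval₂Hom,
        MvPolynomial.eval₂_X]
      rfl
  have h2 : ψ q = HomogeneousLocalization.Away.mk (coordGrading k n) (X_mem k n j) N q hq := by
    apply HomogeneousLocalization.val_injective
    rw [HomogeneousLocalization.Away.val_mk]
    have h3 := eval_homogeneous (algebraMap (MvPolynomial (Fin (n + 1)) k)
      (Localization (Submonoid.powers (MvPolynomial.X j : MvPolynomial (Fin (n + 1)) k))))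
      ((algebraMap (HomogeneousLocalization.Away (coordGrading k n) (MvPolynomial.X j))
        (Localization.Away (MvPolynomial.X j))).comp ψ) (algebraMap _ _ (MvPolynomial.X j))
      (fun c => by
        simp only [RingHom.comp_apply, ψ, MvPolynomial.coe_eval₂Hom, MvPolynomial.eval₂_C,
          HomogeneousLocalization.algebraMap_apply]
        rfl)
      (fun l => by
        simp only [RingHom.comp_apply, ψ, MvPolynomial.coe_eval₂Hom, MvPolynomial.eval₂_X,
          HomogeneousLocalization.algebraMap_apply, HomogeneousLocalization.Away.val_mk]
        rw [Localization.mk_eq_mk', eq_comm]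
        simp only [pow_one]
        exact IsLocalization.mk'_spec _ _ _) ((MvPolynomial.mem_homogeneousSubmodule _ _).1 hq)
    rw [smul_eq_mul, mul_one] at h3
    rw [Localization.mk_eq_mk', IsLocalization.eq_mk'_iff_mul_eq, h3]
    simp
  rw [← h2]
  exact congr($h1 q)

theorem isAffineOpen_chart [IsAffineHom ι] (j : Fin (n + 1)) : IsAffineOpen (chart ι j) :=
  (Proj.isAffineOpen_basicOpen (coordGrading k n) _ (X_mem k n j) one_pos).preimage ι

/-- On a closed subscheme, each function on `U_j` is `p / x_j ^ e` for some form `p`. -/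
theorem exists_gradedEval_eq [IsClosedImmersion ι] (j : Fin (n + 1)) (b : Γ(X, chart ι j)) :
    ∃ N : ℕ, ∀ e, N ≤ e → ∃ p, gradedEval ι j p = Polynomial.C b * Polynomial.X ^ e := by
  obtain ⟨b', rfl⟩ := ι.app_surjective _
    (Proj.isAffineOpen_basicOpen (coordGrading k n) _ (X_mem k n j) one_pos) b
  obtain ⟨z, rfl⟩ : ∃ z, Proj.awayToSection (coordGrading k n) (MvPolynomial.X j) z = b' :=
    ⟨_, congr($((Proj.basicOpenIsoAway (coordGrading k n) _ (X_mem k n j) one_pos).inv_hom_id)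
      b')⟩
  obtain ⟨N, q, hq, rfl⟩ := HomogeneousLocalization.Away.mk_surjective _ (X_mem k n j) z
  refine ⟨N, fun e he => ⟨q * MvPolynomial.X j ^ (e - N), ?_⟩⟩
  rw [map_mul, map_pow, gradedEval_X_self, gradedEval_of_isHomogeneous ι j
    ((MvPolynomial.mem_homogeneousSubmodule _ _).1 hq), app_awayToSection_mk, mul_assoc, ← pow_add,
    smul_eq_mul, mul_one, Nat.add_sub_cancel' he]

/-- Where x_j / x_i is invertible it is a unit of the local ring, so x_j lies outside the prime. -/
theorem basicOpen_projRatio_le (k : Type u) [Field k] (n : ℕ) (i j : Fin (n + 1)) :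
    (projSpace k n).basicOpen (projRatio k n i j) ≤
      Proj.basicOpen (coordGrading k n) (MvPolynomial.X j) := by
  intro x hx
  have hle := (projSpace k n).basicOpen_le (projRatio k n i j)
  obtain ⟨g, hg⟩ := (exists_unit_res (projRatio k n i j) le_rfl).exists_right_inv
  have h1 := congrArg (fun z : Γ(projSpace k n, (projSpace k n).basicOpen (projRatio k n i j)) =>
    (z.1 ⟨x, hx⟩).val) hg
  have h2 := (HomogeneousLocalization.val_mul _ _).symm.trans
    (h1.trans HomogeneousLocalization.val_one)
  have h3 := IsUnit.of_mul_eq_one _ ((congrArg (· * (g.1 ⟨x, hx⟩).val)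
    (projRatio_val k n i j hle ⟨x, hx⟩)).symm.trans h2)
  rw [Localization.mk_eq_mk'] at h3
  have := x.isPrime
  exact (IsLocalization.AtPrime.isUnit_mk'_iff _ x.asHomogeneousIdeal.toIdeal _ _).1 h3

theorem basicOpen_ratio (i j : Fin (n + 1)) :
    chart ι i ⊓ chart ι j = X.basicOpen (ratio ι i j) := by
  refine le_antisymm ?_ (le_inf (X.basicOpen_le _) ?_)
  · have := X.basicOpen_of_isUnit (transition ι i j).isUnit
    rw [show ((transition ι i j : (Γ(X, chart ι i ⊓ chart ι j))ˣ) :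
      Γ(X, chart ι i ⊓ chart ι j)) =
        X.presheaf.map (homOfLE inf_le_left).op (ratio ι i j) from rfl,
      Scheme.basicOpen_res] at this
    rw [← this]
    exact inf_le_right
  · rw [ratio, ← Scheme.preimage_basicOpen]
    exact fun x hx => basicOpen_projRatio_le k n i j hx

end Charts


/-! ### Γ_*(E) seen on one chart -/

section Coordinates

variable {k : Type u} [Field k] {n : ℕ} {X : Scheme.{u}} (ι : X ⟶ projSpace k n) (E : X.Modules)

/-- The homogeneous part of degree `c` of an element of `Γ_*(E)`, on the chart `U_j`. -/
def GammaStar.coord (c : ℤ) (j : Fin (n + 1)) : GammaStar ι E →ₗ[k] ChartSections ι E j :=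
  (LinearMap.proj j ∘ₗ (twistedSections ι E c).subtype) ∘ₗ
    DirectSum.component k ℤ (fun d => twistedSections ι E d) c

variable {ι E}

theorem GammaStar.coord_of (c d : ℤ) (j : Fin (n + 1)) (s : twistedSections ι E d) :
    GammaStar.coord ι E c j (GammaStar.of ι E d s) = if c = d then s.1 j else 0 := by
  split_ifs with h
  · subst h
    exact congrArg (fun t : twistedSections ι E c => t.1 j)
      (DirectSum.component.lof_self k (M := fun d => twistedSections ι E d) c s)
  · exact congrArg (fun t : twistedSections ι E c => t.1 j)
      ((DirectSum.component.of k (M := fun d => twistedSections ι E d) c d s).trans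
        (dif_neg (Ne.symm h)))

theorem GammaStar.ext {m m' : GammaStar ι E}
    (h : ∀ c j, GammaStar.coord ι E c j m = GammaStar.coord ι E c j m') : m = m' := by
  refine DFinsupp.ext fun c => ?_
  apply Subtype.ext
  funext j
  exact h c j

theorem GammaStar.induction {P : GammaStar ι E → Prop} (zero : P 0)
    (of : ∀ d s, P (GammaStar.of ι E d s)) (add : ∀ m m', P m → P m' → P (m + m')) (m) : P m :=
  DirectSum.induction_on m zero of add

/-- The coefficient of T^e in `gradedEval` is the degree e part of p divided by x_j^e, and that part
raises degrees by e. In the induction a variable is moved from p onto s. -/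
theorem coord_smul_of (c d : ℤ) (j : Fin (n + 1)) (p : MvPolynomial (Fin (n + 1)) k)
    (s : twistedSections ι E d) :
    GammaStar.coord ι E c j (p • GammaStar.of ι E d s) =
      if d ≤ c then (gradedEval ι j p).coeff (c - d).toNat • s.1 j else 0 := by
  induction p using MvPolynomial.induction_on generalizing d with
  | C a =>
    rw [← MvPolynomial.algebraMap_eq, algebraMap_smul, map_smul, GammaStar.coord_of,
      MvPolynomial.algebraMap_eq, gradedEval_C, Polynomial.coeff_C]
    by_cases h : c = d
    · subst h
      simp only [if_true, le_refl, sub_self, Int.toNat_zero]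
      exact const_smul_def ι E a _
    · rw [if_neg h, smul_zero]
      split_ifs with h1 h2
      · omega
      · rw [zero_smul]
      · rfl
  | add p q hp hq =>
    rw [add_smul, map_add, hp, hq, map_add, Polynomial.coeff_add]
    split_ifs
    · rw [add_smul]
    · rw [add_zero]
  | mul_X p l hp =>
    have h1 : (p * MvPolynomial.X l) • GammaStar.of ι E d s =
        p • GammaStar.of ι E (d + 1) (mulCoord ι E l d s) := by
      rw [mul_smul, ← coordEnd_of, ← coordAction_X]
      rfl
    have hq : gradedEval ι j p * (Polynomial.C (ratio ι j l) * Polynomial.X) =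
        Polynomial.C (ratio ι j l) * gradedEval ι j p * Polynomial.X := by ring
    rw [h1, hp, map_mul, gradedEval_X, hq]
    by_cases h : d + 1 ≤ c
    · have h2 : (c - d).toNat = (c - (d + 1)).toNat + 1 := by omega
      rw [if_pos h, if_pos (by omega), h2, Polynomial.coeff_mul_X, Polynomial.coeff_C_mul, mul_comm,
        mul_smul]
      rfl
    · rw [if_neg h]
      split_ifs with h2
      · rw [show (c - d).toNat = 0 by omega, Polynomial.mul_coeff_zero, Polynomial.mul_coeff_zero]
        simp
      · rfl

theorem gradedEval_coeff_zero (ι : X ⟶ projSpace k n) (j : Fin (n + 1))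
    (p : MvPolynomial (Fin (n + 1)) k) : (gradedEval ι j p).coeff 0 =
      constOn ι (chart ι j) (MvPolynomial.constantCoeff p) := by
  have : ((Polynomial.constantCoeff).comp (gradedEval ι j)) =
      (constOn ι (chart ι j)).comp MvPolynomial.constantCoeff := by
    refine MvPolynomial.ringHom_ext (fun c => ?_) fun l => ?_
    · simp [gradedEval_C]
    · simp [gradedEval_X]
  exact congr($this p)

/-- The degree zero part of the action of `p` on `Γ_*(E)` is given by the constant term of `p`. -/
theorem coord_smul_of_self (d : ℤ) (j : Fin (n + 1)) (p : MvPolynomial (Fin (n + 1)) k)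
    (s : twistedSections ι E d) :
    GammaStar.coord ι E d j (p • GammaStar.of ι E d s) =
      MvPolynomial.constantCoeff p • s.1 j := by
  rw [coord_smul_of, if_pos le_rfl, sub_self, Int.toNat_zero, gradedEval_coeff_zero]
  rfl

theorem coord_smul_of_monomial {c d : ℤ} {j : Fin (n + 1)} {p : MvPolynomial (Fin (n + 1)) k}
    {b : Γ(X, chart ι j)} {e : ℕ} (hp : gradedEval ι j p = Polynomial.C b * Polynomial.X ^ e)
    (s : twistedSections ι E d) :
    GammaStar.coord ι E c j (p • GammaStar.of ι E d s) = if c = d + e then b • s.1 j else 0 := by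
  rw [coord_smul_of, hp, Polynomial.coeff_C_mul_X_pow]
  split_ifs with h1 h2 h3 h4 h5
  · rfl
  · omega
  · omega
  · rw [zero_smul]
  · omega
  · rfl

/-- A polynomial identity satisfied by `Γ_*(f)` also holds for the constant terms of the
coefficients. -/
theorem aeval_constantCoeff_gammaStarMap (f : End E)
    (Q : Polynomial (MvPolynomial (Fin (n + 1)) k))
    (hQ : Polynomial.aeval (gammaStarMap ι f) Q = 0) :
    Polynomial.aeval ((gammaStarMap ι f).restrictScalars k)
      (Q.map (MvPolynomial.constantCoeff : MvPolynomial (Fin (n + 1)) k →+* k)) = 0 := by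
  have hpow : ∀ (l : ℕ) (d : ℤ) (s : twistedSections ι E d),
      ∃ t : twistedSections ι E d, (gammaStarMap ι f ^ l) (GammaStar.of ι E d s) =
        GammaStar.of ι E d t := by
    intro l d
    induction l with
    | zero => exact fun s => ⟨s, rfl⟩
    | succ l ih =>
      intro s
      obtain ⟨t, ht⟩ := ih s
      refine ⟨twistedMap ι f d t, ?_⟩
      rw [pow_succ', Module.End.mul_apply, ht]
      exact gammaStarMapAux_of ι f d t
  have hpow' : ∀ (l : ℕ) (m : GammaStar ι E),
      ((gammaStarMap ι f).restrictScalars k ^ l) m = (gammaStarMap ι f ^ l) m := by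
    intro l m
    induction l with
    | zero => rfl
    | succ l ih => rw [pow_succ', pow_succ', Module.End.mul_apply, Module.End.mul_apply, ih]; rfl
  -- As φ preserves degrees, only the constant terms of the coefficients of Q contribute to the
  -- component in the original degree d.
  have key : ∀ (Q : Polynomial (MvPolynomial (Fin (n + 1)) k)) (d : ℤ)
      (s : twistedSections ι E d) (c : ℤ) (j : Fin (n + 1)),
      GammaStar.coord ι E c j (Polynomial.aeval ((gammaStarMap ι f).restrictScalars k)
        (Q.map (MvPolynomial.constantCoeff : MvPolynomial (Fin (n + 1)) k →+* k))
          (GammaStar.of ι E d s)) =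
      if c = d then GammaStar.coord ι E c j
        (Polynomial.aeval (gammaStarMap ι f) Q (GammaStar.of ι E d s)) else 0 := by
    intro Q d s c j
    induction Q using Polynomial.induction_on' with
    | add p q hp hq =>
      rw [Polynomial.map_add, map_add, map_add, LinearMap.add_apply, LinearMap.add_apply, map_add,
        map_add, hp, hq]
      split_ifs
      · rfl
      · rw [add_zero]
    | monomial l a =>
      obtain ⟨t, ht⟩ := hpow l d s
      rw [Polynomial.map_monomial, Polynomial.aeval_monomial, Polynomial.aeval_monomial,
        Module.End.mul_apply, Module.End.mul_apply, hpow', ht, Module.algebraMap_end_apply,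
        Module.algebraMap_end_apply, map_smul, GammaStar.coord_of]
      split_ifs with h
      · subst h
        rw [coord_smul_of_self]
      · rw [smul_zero]
  ext m
  induction m using GammaStar.induction with
  | zero => rw [map_zero, map_zero]
  | of d s =>
    refine GammaStar.ext fun c j => ?_
    rw [key, hQ, LinearMap.zero_apply, LinearMap.zero_apply, map_zero, ite_self]
  | add m m' h h' => rw [map_add, h, h', map_add]

section Integral

variable [IsIntegral X] (hE : IsVectorBundle E)
include hE

/-- The cocycle condition determines s_i on U_i ∩ U_j from s_j, and sections are determined on
nonempty opens. -/
theorem IsVectorBundle.twistedSections_ext {j : Fin (n + 1)}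
    (hj : (chart ι j : Set X).Nonempty) {d : ℤ} {s t : twistedSections ι E d}
    (h : s.1 j = t.1 j) : s = t := by
  apply Subtype.ext
  funext i
  refine hE.ext_of_nonempty hj _ _ ((s.2 i j).trans (Eq.trans ?_ (t.2 i j).symm))
  rw [h]

theorem IsVectorBundle.gammaStar_ext {j : Fin (n + 1)}
    (hj : (chart ι j : Set X).Nonempty) {m m' : GammaStar ι E}
    (h : ∀ c, GammaStar.coord ι E c j m = GammaStar.coord ι E c j m') : m = m' :=
  DFinsupp.ext fun c => hE.twistedSections_ext hj (h c)

theorem IsVectorBundle.smul_eq_zero_of_mem_ker {j : Fin (n + 1)}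
    (hj : (chart ι j : Set X).Nonempty) {p : MvPolynomial (Fin (n + 1)) k}
    (hp : gradedEval ι j p = 0) (m : GammaStar ι E) : p • m = 0 := by
  induction m using GammaStar.induction with
  | zero => rw [smul_zero]
  | of d s =>
    refine hE.gammaStar_ext hj fun c => ?_
    rw [coord_smul_of, hp, map_zero, Polynomial.coeff_zero, zero_smul, ite_self]
  | add m m' h h' => rw [smul_add, h, h', add_zero]

/-- Compare leading terms: in degree D + e only the top component of m meets the top coefficient of
p, and sections of E have no torsion. -/
theorem IsVectorBundle.gammaStar_smul_eq_zero {j : Fin (n + 1)}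
    (hj : (chart ι j : Set X).Nonempty) {p : MvPolynomial (Fin (n + 1)) k}
    {m : GammaStar ι E} (h : p • m = 0) : gradedEval ι j p = 0 ∨ m = 0 := by
  by_contra! hne
  obtain ⟨hp, hm⟩ := hne
  classical
  let m' : DirectSum ℤ fun d => twistedSections ι E d := m
  have hsum : ∑ d ∈ m'.support, GammaStar.of ι E d (m' d) = m :=
    DirectSum.sum_support_of m'
  have hne : m'.support.Nonempty := Finset.nonempty_iff_ne_empty.2 fun h0 => hm (by
    rw [← hsum, h0, Finset.sum_empty])
  set D := m'.support.max' hne with hD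
  set e := (gradedEval ι j p).natDegree with he
  have hD0 : m' D ≠ 0 := DFinsupp.mem_support_iff.1 (Finset.max'_mem _ hne)
  have h1 := congrArg (GammaStar.coord ι E (D + e) j) h
  rw [← hsum, Finset.smul_sum, map_sum, map_zero,
    Finset.sum_eq_single_of_mem D (Finset.max'_mem _ hne), coord_smul_of, if_pos (by omega),
    add_sub_cancel_left, Int.toNat_natCast] at h1
  · rcases hE.smul_eq_zero h1 with h2 | h2
    · exact hp (Polynomial.leadingCoeff_eq_zero.1 h2)
    · exact hD0 (hE.twistedSections_ext hj h2)
  · intro d hd hdD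
    have hlt : d < D := lt_of_le_of_ne (Finset.le_max' _ _ hd) hdD
    rw [coord_smul_of, if_pos (by omega), Polynomial.coeff_eq_zero_of_natDegree_lt (by omega),
      zero_smul]

/-- Sections of `E` over a chart extend to twisted global sections. -/
theorem IsVectorBundle.exists_twistedSections_eq [IsAffineHom ι] (j : Fin (n + 1))
    (s : Γ(E, chart ι j)) :
    ∃ N : ℕ, ∀ m : ℕ, N ≤ m → ∃ t : twistedSections ι E m, t.1 j = s := by
  by_cases hj : (chart ι j : Set X).Nonempty
  swap
  · exact ⟨0, fun m _ => ⟨0, (section_eq_zero_of_isEmpty E hj _).symm⟩⟩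
  -- The twisted section is x_j^m s. On U_i it reads (x_j / x_i)^m s, which extends from U_i ∩ U_j =
  -- D(x_j / x_i) once m is large.
  choose N hN using fun i => hE.exists_extension (isAffineOpen_chart ι i) (ratio ι i j)
    inf_le_left (basicOpen_ratio ι i j) (res E (inf_le_right : chart ι i ⊓ chart ι j ≤ _) s)
  refine ⟨∑ i, N i, fun m hm => ?_⟩
  choose t ht using fun i => hN i m ((Finset.single_le_sum (f := N) (fun _ _ => Nat.zero_le _)
    (Finset.mem_univ i)).trans hm)
  refine ⟨⟨t, fun i l => ?_⟩, ?_⟩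
  · refine hE.ext_of_nonempty hj _ _ ?_
    have h1 := congrArg (res E (inf_le_inf_right _ inf_le_left :
      chart ι i ⊓ chart ι l ⊓ chart ι j ≤ chart ι i ⊓ chart ι j)) (ht i)
    have h2 := congrArg (res E (inf_le_inf_right _ inf_le_right :
      chart ι i ⊓ chart ι l ⊓ chart ι j ≤ chart ι l ⊓ chart ι j)) (ht l)
    have h3 := congrArg (X.presheaf.map (homOfLE (inf_le_left :
      chart ι i ⊓ chart ι l ⊓ chart ι j ≤ chart ι i ⊓ chart ι l)).op) (ratio_mul ι i l j)
    have h4 : ∀ (a : Γ(X, chart ι i ⊓ chart ι l)) (z : Γ(E, chart ι i ⊓ chart ι l)),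
      res E (inf_le_left : chart ι i ⊓ chart ι l ⊓ chart ι j ≤ _) (a • z) =
        X.presheaf.map (homOfLE inf_le_left).op a • res E inf_le_left z := res_smul E _
    rw [map_mul, fun_res_res, fun_res_res, fun_res_res] at h3
    rw [res_res, res_smul, map_pow, fun_res_res, res_res] at h1 h2
    have h5 : res E (inf_le_left : chart ι i ⊓ chart ι l ⊓ chart ι j ≤ _)
        (res E (inf_le_left : chart ι i ⊓ chart ι l ≤ _) (t i)) =
      res E (inf_le_left : chart ι i ⊓ chart ι l ⊓ chart ι j ≤ _)
        (((transition ι i l ^ (m : ℤ) : (Γ(X, chart ι i ⊓ chart ι l))ˣ) :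
          Γ(X, chart ι i ⊓ chart ι l)) •
        res E (inf_le_right : chart ι i ⊓ chart ι l ≤ _) (t l)) := by
      rw [res_res, h1, h4, res_res, h2, zpow_natCast, Units.val_pow_eq_pow_val, map_pow, h3,
        mul_pow, mul_smul]
      congr 2
      exact (fun_res_res _ _ _).symm
    exact h5
  · have h1 := ht j
    rw [ratio_self, map_one, one_pow, one_smul] at h1
    refine hE.res_injective (inf_le_left : chart ι j ⊓ chart ι j ≤ chart ι j) ?_ h1
    exact inf_nonempty hj hj

end Integral

end Coordinates

/-! ### Finiteness of Γ_*(E) -/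

section Finiteness

variable {k : Type u} [Field k] {n : ℕ} {X : Scheme.{u}} {ι : X ⟶ projSpace k n} {E : X.Modules}

theorem iSup_chart (ι : X ⟶ projSpace k n) : ⨆ j, chart ι j = ⊤ := by
  have h : ⨆ j : Fin (n + 1), Proj.basicOpen (coordGrading k n) (MvPolynomial.X j) = ⊤ := by
    refine Proj.iSup_basicOpen_eq_top' (coordGrading k n) _ (fun i => ⟨1, X_mem k n i⟩) ?_
    refine top_le_iff.1 fun p _ => ?_
    induction p using MvPolynomial.induction_on with
    | C c => exact Subalgebra.algebraMap_mem _ (algebraMap k (coordGrading k n 0) c)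
    | add p q hp hq => exact add_mem (hp trivial) (hq trivial)
    | mul_X p i hp => exact mul_mem (hp trivial) (Algebra.subset_adjoin ⟨i, rfl⟩)
  rw [← Scheme.Hom.preimage_iSup, h]
  rfl

theorem exists_mem_chart (ι : X ⟶ projSpace k n) (x : X) : ∃ j, x ∈ chart ι j :=
  TopologicalSpace.Opens.mem_iSup.1 ((iSup_chart ι).ge (Set.mem_univ x))

theorem gradedEval_X_self_pow (ι : X ⟶ projSpace k n) (j : Fin (n + 1)) (N : ℕ) :
    gradedEval ι j (MvPolynomial.X j ^ N) = Polynomial.C 1 * Polynomial.X ^ N := by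
  rw [map_pow, gradedEval_X_self, map_one, one_mul]

variable [IsIntegral X] (hE : IsVectorBundle E)
include hE

/-- Extend generators σ of the sections over U_j to twisted sections t_σ. If s_j = ∑ b_σ σ, then for
large N the functions b_σ come from polynomials p_σ in the degrees for which x_j^N s = ∑ p_σ t_σ;
this is checked on U_j alone. -/
theorem IsVectorBundle.exists_finite_span_chart [IsClosedImmersion ι] {j : Fin (n + 1)}
    (hj : (chart ι j : Set X).Nonempty) :
    ∃ T : Set (GammaStar ι E), T.Finite ∧ ∀ m, ∃ N : ℕ,
      (MvPolynomial.X j ^ N : MvPolynomial (Fin (n + 1)) k) • m ∈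
        Submodule.span (MvPolynomial (Fin (n + 1)) k) T := by
  obtain ⟨G, hG⟩ := (hE.finite_sections (isAffineOpen_chart ι j)).fg_top
  choose D hD using fun σ : Γ(E, chart ι j) => hE.exists_twistedSections_eq (ι := ι) j σ
  choose t ht using fun σ => hD σ (D σ) le_rfl
  refine ⟨(fun σ => GammaStar.of ι E (D σ) (t σ)) '' (G : Set Γ(E, chart ι j)),
    G.finite_toSet.image _, fun m => ?_⟩
  induction m using GammaStar.induction with
  | zero => exact ⟨0, by rw [smul_zero]; exact zero_mem _⟩
  | of d s =>
    obtain ⟨b, -, hb⟩ := Submodule.mem_span_finset.1 (hG.ge (Submodule.mem_top (x := s.1 j)))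
    choose K hK using fun σ => exists_gradedEval_eq ι j (b σ)
    have hle : ∀ σ ∈ G, K σ + D σ ≤ ∑ σ ∈ G, (K σ + D σ) := fun σ hσ =>
      Finset.single_le_sum (f := fun σ => K σ + D σ) (fun _ _ => Nat.zero_le _) hσ
    -- The choice makes d + N - D σ at least K σ for all σ in G, even when d is negative.
    set N := d.natAbs + ∑ σ ∈ G, (K σ + D σ) with hN
    have : ∀ σ : Γ(E, chart ι j), ∃ p, σ ∈ G → gradedEval ι j p =
        Polynomial.C (b σ) * Polynomial.X ^ (d + N - D σ).toNat := fun σ => by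
      by_cases hσ : σ ∈ G
      · obtain ⟨p, hp⟩ := hK σ (d + N - D σ).toNat (by have := hle σ hσ; omega)
        exact ⟨p, fun _ => hp⟩
      · exact ⟨0, fun h => (hσ h).elim⟩
    choose p hp using this
    refine ⟨N, ?_⟩
    have key : (MvPolynomial.X j ^ N : MvPolynomial (Fin (n + 1)) k) • GammaStar.of ι E d s =
        ∑ σ ∈ G, p σ • GammaStar.of ι E (D σ) (t σ) := by
      refine hE.gammaStar_ext hj fun c => ?_
      rw [coord_smul_of_monomial (gradedEval_X_self_pow ι j N), map_sum, one_smul]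
      trans ∑ σ ∈ G, if c = d + N then (b σ • σ : ChartSections ι E j) else 0
      · split_ifs
        · refine hb.symm.trans (Finset.sum_congr rfl fun σ _ => ?_)
          exact (if_pos ‹_›).symm
        · refine Eq.trans ?_ (Finset.sum_congr rfl fun σ _ => (if_neg ‹_›).symm)
          exact Finset.sum_const_zero.symm
      · refine Finset.sum_congr rfl fun σ hσ => ?_
        have := hle σ hσ
        rw [coord_smul_of_monomial (hp σ hσ), ht]
        congr 1
        rw [eq_iff_iff]
        omega
    rw [key]
    exact Submodule.sum_mem _ fun σ hσ =>
      Submodule.smul_mem _ _ (Submodule.subset_span ⟨σ, hσ, rfl⟩)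
  | add m m' h h' =>
    obtain ⟨N, hN⟩ := h
    obtain ⟨N', hN'⟩ := h'
    refine ⟨N + N', ?_⟩
    rw [smul_add]
    refine add_mem ?_ ?_
    · rw [Nat.add_comm N, pow_add, mul_smul]
      exact Submodule.smul_mem _ _ hN
    · rw [pow_add, mul_smul]
      exact Submodule.smul_mem _ _ hN'

theorem IsVectorBundle.exists_finite_span [IsClosedImmersion ι] :
    ∃ T : Set (GammaStar ι E), T.Finite ∧ ∀ m j, ∃ N : ℕ,
      (MvPolynomial.X j ^ N : MvPolynomial (Fin (n + 1)) k) • m ∈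
        Submodule.span (MvPolynomial (Fin (n + 1)) k) T := by
  obtain ⟨j₀, hj₀⟩ := exists_mem_chart ι (Classical.arbitrary X)
  have : ∀ j, ∃ T : Set (GammaStar ι E), T.Finite ∧ ∀ m, ∃ N : ℕ,
      (MvPolynomial.X j ^ N : MvPolynomial (Fin (n + 1)) k) • m ∈
        Submodule.span (MvPolynomial (Fin (n + 1)) k) T := by
    intro j
    by_cases hj : (chart ι j : Set X).Nonempty
    · exact hE.exists_finite_span_chart hj
    -- If U_j is empty, x_j vanishes on X and already acts by zero.
    · refine ⟨∅, Set.finite_empty, fun m => ⟨1, ?_⟩⟩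
      rw [pow_one, hE.smul_eq_zero_of_mem_ker ⟨_, hj₀⟩]
      · exact zero_mem _
      · rw [gradedEval_X, (basicOpen_eq_bot_iff (ratio ι j₀ j)).1, map_zero, zero_mul]
        rw [← basicOpen_ratio]
        exact le_bot_iff.1 fun x hx => (hj ⟨x, hx.2⟩).elim
  choose T hT hT' using this
  refine ⟨⋃ j, T j, Set.finite_iUnion hT, fun m j => ?_⟩
  obtain ⟨N, hN⟩ := hT' j m
  exact ⟨N, Submodule.span_mono (Set.subset_iUnion T j) hN⟩

end Finiteness


theorem mem_irrelevantIdeal {k : Type u} [Field k] {n : ℕ} {p : MvPolynomial (Fin (n + 1)) k} :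
    p ∈ irrelevantIdeal k n ↔ MvPolynomial.constantCoeff p = 0 := by
  constructor
  · intro h
    have : irrelevantIdeal k n ≤ RingHom.ker (MvPolynomial.constantCoeff (R := k)) :=
      Ideal.span_le.2 (by rintro _ ⟨i, rfl⟩; exact MvPolynomial.constantCoeff_X k i)
    exact this h
  · have : ∀ p, p - MvPolynomial.C (MvPolynomial.constantCoeff p) ∈ irrelevantIdeal k n := by
      intro p
      induction p using MvPolynomial.induction_on with
      | C c => simp
      | add p q hp hq => rw [map_add, map_add, add_sub_add_comm]; exact add_mem hp hq
      | mul_X p i hp =>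
        rw [map_mul, MvPolynomial.constantCoeff_X, mul_zero, map_zero, sub_zero]
        exact Ideal.mul_mem_left _ _ (Ideal.subset_span ⟨i, rfl⟩)
    intro h
    simpa [h] using this p

section Finiteness

variable {k : Type u} [Field k] {n : ℕ} {X : Scheme.{u}} {ι : X ⟶ projSpace k n} {E : X.Modules}

theorem IsDomain.of_nonempty [IsIntegral X] {U : X.Opens} (hU : (U : Set X).Nonempty) :
    IsDomain Γ(X, U) :=
  have : Nonempty U := hU.to_subtype
  inferInstance

/-- Over U_i ∩ U_j the two substitutions differ by T ↦ (x_j / x_i) T, and restriction from U_i is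
injective. Hence the kernel is the same for all nonempty charts. -/
theorem gradedEval_eq_zero [IsIntegral X] {i j : Fin (n + 1)} (hj : (chart ι j : Set X).Nonempty)
    (hi : (chart ι i : Set X).Nonempty)
    {p : MvPolynomial (Fin (n + 1)) k} (hp : gradedEval ι j p = 0) : gradedEval ι i p = 0 := by
  let ρ := (X.presheaf.map (homOfLE (inf_le_left : chart ι i ⊓ chart ι j ≤ chart ι i)).op).hom
  let ρ' := (X.presheaf.map (homOfLE (inf_le_right : chart ι i ⊓ chart ι j ≤ chart ι j)).op).hom
  have h : (Polynomial.mapRingHom ρ).comp (gradedEval ι i) =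
      ((Polynomial.eval₂RingHom Polynomial.C
        (Polynomial.C (ρ (ratio ι i j)) * Polynomial.X)).comp (Polynomial.mapRingHom ρ')).comp
          (gradedEval ι j) := by
    refine MvPolynomial.ringHom_ext (fun c => ?_) fun l => ?_
    · simp only [RingHom.comp_apply, gradedEval_C, Polynomial.coe_mapRingHom, Polynomial.map_C,
        Polynomial.coe_eval₂RingHom, Polynomial.eval₂_C]
      exact congrArg _ ((res_constOn ι inf_le_left c).trans (res_constOn ι inf_le_right c).symm)
    · simp only [RingHom.comp_apply, gradedEval_X, Polynomial.coe_mapRingHom, Polynomial.map_mul,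
        Polynomial.map_C, Polynomial.map_X, Polynomial.coe_eval₂RingHom, Polynomial.eval₂_mul,
        Polynomial.eval₂_C, Polynomial.eval₂_X]
      rw [show ρ (ratio ι i l) = ρ (ratio ι i j) * ρ' (ratio ι j l) from ratio_mul ι i j l,
        Polynomial.C_mul]
      ring
  have hinj : Function.Injective ρ := by
    have : Nonempty (chart ι i ⊓ chart ι j : X.Opens) := (inf_nonempty hi hj).to_subtype
    exact map_injective_of_isIntegral X _
  apply Polynomial.map_injective ρ hinj
  have := congr($h p)
  simp only [RingHom.comp_apply, hp, map_zero] at this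
  rw [Polynomial.map_zero]
  exact this

theorem constantCoeff_eq_zero {A : Type*} [CommRing A] [Nontrivial A] {j : Fin (n + 1)}
    (ev : Γ(X, chart ι j) →+* A) {p : MvPolynomial (Fin (n + 1)) k}
    (hp : Polynomial.map ev (gradedEval ι j p) = 0) : MvPolynomial.constantCoeff p = 0 := by
  have h := congrArg (Polynomial.coeff · 0) hp
  simp only [Polynomial.coeff_map, gradedEval_coeff_zero, Polynomial.coeff_zero] at h
  exact (map_eq_zero (ev.comp (constOn ι (chart ι j)))).1 h

/-- The kernel 𝔭 of `gradedEval` acts by zero, and R = S/𝔭 is a domain over which M is torsion-free.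
The zero x of x_j gives a prime strictly between 0 and the irrelevant ideal: the kernel of S →
κ(x)[T], which contains x_j but not x_i when x lies in U_i. -/
theorem IsVectorBundle.finite_gammaStar [IsIntegral X] [IsClosedImmersion ι]
    (hE : IsVectorBundle E) {j : Fin (n + 1)} (hj : (chart ι j : Set X).Nonempty) {x : X}
    (hx : x ∉ chart ι j) : Module.Finite (MvPolynomial (Fin (n + 1)) k) (GammaStar ι E) := by
  have := IsDomain.of_nonempty hj
  obtain ⟨i, hxi⟩ := exists_mem_chart ι x
  let 𝔭 := RingHom.ker (gradedEval ι j)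
  have h𝔭 : 𝔭.IsPrime := RingHom.ker_isPrime _
  have htors : Module.IsTorsionBySet (MvPolynomial (Fin (n + 1)) k) (GammaStar ι E) 𝔭 :=
    fun m a => hE.smul_eq_zero_of_mem_ker hj a.2 m
  let := htors.module
  have htower : IsScalarTower (MvPolynomial (Fin (n + 1)) k) (MvPolynomial (Fin (n + 1)) k ⧸ 𝔭)
    (GammaStar ι E) := htors.isScalarTower
  have hsmul : ∀ p (m : GammaStar ι E), Ideal.Quotient.mk 𝔭 p • m = p • m := fun p m => rfl
  let ev := X.evaluation (chart ι i) x hxi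
  let Ψ : MvPolynomial (Fin (n + 1)) k →+* Polynomial (X.residueField x) :=
    (Polynomial.mapRingHom ev.hom).comp (gradedEval ι i)
  have hΨ : ∀ p ∈ 𝔭, Ψ p = 0 := fun p hp => by
    rw [RingHom.comp_apply, gradedEval_eq_zero hj ⟨x, hxi⟩ hp, map_zero]
  have hε : ∀ p, Ψ p = 0 → MvPolynomial.constantCoeff p = 0 := fun p hp =>
    constantCoeff_eq_zero ev.hom hp
  obtain ⟨T, hT, hT'⟩ := hE.exists_finite_span (ι := ι)
  have hq : (RingHom.ker (Ideal.Quotient.lift 𝔭 Ψ hΨ)).IsPrime := RingHom.ker_isPrime _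
  have hfin : Module.Finite (MvPolynomial (Fin (n + 1)) k ⧸ 𝔭) (GammaStar ι E) := by
    refine finite_of_saturation_maximal (k := k) (fun r m h => ?_)
      (RingHom.ker (Ideal.Quotient.lift 𝔭 MvPolynomial.constantCoeff fun p hp => hε p (hΨ p hp)))
      (fun r => ?_) (RingHom.ker_ne_top _) (RingHom.ker (Ideal.Quotient.lift 𝔭 Ψ hΨ)) ?_ ?_
      (Submodule.span _ T) (Submodule.fg_span hT) fun m r hr => ?_
    · obtain ⟨p, rfl⟩ := Ideal.Quotient.mk_surjective r
      exact (hE.gammaStar_smul_eq_zero hj h).imp (fun h => Ideal.Quotient.eq_zero_iff_mem.2 h) id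
    · obtain ⟨p, rfl⟩ := Ideal.Quotient.mk_surjective r
      refine ⟨MvPolynomial.constantCoeff p, ?_⟩
      have : algebraMap k (MvPolynomial (Fin (n + 1)) k ⧸ 𝔭) (MvPolynomial.constantCoeff p) =
        Ideal.Quotient.mk 𝔭 (MvPolynomial.C (MvPolynomial.constantCoeff p)) := rfl
      rw [this, ← map_sub, RingHom.mem_ker, Ideal.Quotient.lift_mk]
      simp
    · refine (Submodule.ne_bot_iff _).2 ⟨Ideal.Quotient.mk 𝔭 (MvPolynomial.X j), ?_, fun h => ?_⟩
      · rw [RingHom.mem_ker, Ideal.Quotient.lift_mk, RingHom.comp_apply, gradedEval_X]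
        have : ev (ratio ι i j) = 0 := by
          rw [Scheme.evaluation_eq_zero_iff_notMem_basicOpen, ← basicOpen_ratio]
          exact fun h => hx h.2
        have h2 : ev.hom (ratio ι i j) = 0 := this
        rw [Polynomial.coe_mapRingHom, Polynomial.map_mul, Polynomial.map_C, h2, map_zero, zero_mul]
      · have : gradedEval ι j (MvPolynomial.X j) = 0 := Ideal.Quotient.eq_zero_iff_mem.1 h
        rw [gradedEval_X_self] at this
        exact Polynomial.X_ne_zero this
    · refine lt_of_le_of_ne (fun r hr => ?_) fun h => ?_
      · obtain ⟨p, rfl⟩ := Ideal.Quotient.mk_surjective r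
        rw [RingHom.mem_ker, Ideal.Quotient.lift_mk] at hr ⊢
        exact hε p hr
      · have : Ideal.Quotient.mk 𝔭 (MvPolynomial.X i) ∈
            RingHom.ker (Ideal.Quotient.lift 𝔭 Ψ hΨ) := by
          rw [h, RingHom.mem_ker, Ideal.Quotient.lift_mk, MvPolynomial.constantCoeff_X]
        rw [RingHom.mem_ker, Ideal.Quotient.lift_mk, RingHom.comp_apply, gradedEval_X_self,
          Polynomial.coe_mapRingHom, Polynomial.map_X] at this
        exact Polynomial.X_ne_zero this
    · obtain ⟨p, rfl⟩ := Ideal.Quotient.mk_surjective r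
      rw [RingHom.mem_ker, Ideal.Quotient.lift_mk] at hr
      -- The polynomials moving m into the span form an ideal. Its radical contains every x_l, hence
      -- the whole irrelevant ideal.
      have hle : irrelevantIdeal k n ≤ Ideal.radical
          ((Submodule.span (MvPolynomial (Fin (n + 1)) k) T).comap
            (LinearMap.toSpanSingleton (MvPolynomial (Fin (n + 1)) k) _ m)) := by
        refine Ideal.span_le.2 ?_
        rintro _ ⟨l, rfl⟩
        exact hT' m l
      obtain ⟨N, hN⟩ := hle (mem_irrelevantIdeal.2 hr)
      refine ⟨N, ?_⟩
      rw [← map_pow, hsmul]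
      exact Submodule.span_le_restrictScalars (MvPolynomial (Fin (n + 1)) k) _ T hN
  exact Module.Finite.trans (MvPolynomial (Fin (n + 1)) k ⧸ 𝔭) (GammaStar ι E)

theorem finite_gammaStar_quotient
    [Module.Finite (MvPolynomial (Fin (n + 1)) k) (GammaStar ι E)] :
    Module.Finite k (GammaStar ι E ⧸ irrelevantPart ι E) := by
  obtain ⟨G, hG⟩ := Module.Finite.fg_top (R := MvPolynomial (Fin (n + 1)) k) (M := GammaStar ι E)
  refine ⟨Submodule.fg_def.2 ⟨(irrelevantPart ι E).mkQ '' (G : Set (GammaStar ι E)),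
    G.finite_toSet.image _, top_le_iff.1 fun z _ => ?_⟩⟩
  obtain ⟨m, rfl⟩ := (irrelevantPart ι E).mkQ_surjective z
  obtain ⟨b, -, rfl⟩ := Submodule.mem_span_finset.1 (hG.ge (Submodule.mem_top (x := m)))
  rw [map_sum]
  refine Submodule.sum_mem _ fun m hm => ?_
  have : (irrelevantPart ι E).mkQ (b m • m) =
      MvPolynomial.constantCoeff (b m) • (irrelevantPart ι E).mkQ m := by
    rw [← algebraMap_smul (MvPolynomial (Fin (n + 1)) k) (MvPolynomial.constantCoeff (b m)),
      ← map_smul, ← sub_eq_zero, ← map_sub, ← sub_smul, Submodule.mkQ_apply,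
      Submodule.Quotient.mk_eq_zero]
    refine Submodule.smul_mem_smul (mem_irrelevantIdeal.2 ?_) trivial
    simp [MvPolynomial.algebraMap_eq]
  rw [this]
  exact Submodule.smul_mem _ _ (Submodule.subset_span ⟨m, hm, rfl⟩)

/-- If `x_j` has no zeros on `X`, multiplication by `x_j` is surjective on `Γ_*(E)`, and so
`𝔪 Γ_*(E) = Γ_*(E)`. -/
theorem subsingleton_gammaStar_quotient {j : Fin (n + 1)} (hj : ∀ x, x ∈ chart ι j) :
    Subsingleton (GammaStar ι E ⧸ irrelevantPart ι E) := by
  rw [Submodule.Quotient.subsingleton_iff]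
  refine top_le_iff.1 fun m _ => ?_
  induction m using GammaStar.induction with
  | zero => exact zero_mem _
  | of d s =>
    obtain ⟨d, rfl⟩ : ∃ d', d = d' + 1 := ⟨d - 1, by ring⟩
    -- Since x_j has no zeros, x_j / x_i is a unit on U_i, and s is x_j times the twisted section
    -- with components s_i divided by x_j / x_i.
    have hu : ∀ i, IsUnit (ratio ι i j) := fun i => by
      refine X.toRingedSpace.isUnit_of_isUnit_germ _ _ fun x hx => ?_
      have : x ∈ X.basicOpen (ratio ι i j) := by
        rw [← basicOpen_ratio]
        exact ⟨hx, hj x⟩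
      exact (X.mem_basicOpen (ratio ι i j) x hx).1 this
    choose u hu using hu
    let t : twistedSections ι E d := ⟨fun i => (u i)⁻¹.1 • s.1 i, fun i l => by
      let ρ := (X.presheaf.map (homOfLE (inf_le_left : chart ι i ⊓ chart ι l ≤ chart ι i)).op).hom
      let ρ' := (X.presheaf.map (homOfLE (inf_le_right : chart ι i ⊓ chart ι l ≤ _)).op).hom
      have h : Units.map ρ.toMonoidHom (u i) =
          transition ι i l * Units.map ρ'.toMonoidHom (u l) := by
        apply Units.ext
        refine (congrArg ρ (hu i)).trans ((ratio_mul ι i l j).trans ?_)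
        rw [← hu l]
        rfl
      have h' : Units.map ρ.toMonoidHom (u i)⁻¹ * transition ι i l ^ (d + 1) =
          transition ι i l ^ d * Units.map ρ'.toMonoidHom (u l)⁻¹ := by
        rw [map_inv, map_inv, h, zpow_add_one, mul_inv, mul_comm]
        group
      rw [chartRes_smul, chartRes_smul, s.2 i l, smul_smul, smul_smul]
      exact congrArg (fun a : (Γ(X, chart ι i ⊓ chart ι l))ˣ => a.1 •
        chartRes ι E (inf_le_right : chart ι i ⊓ chart ι l ≤ _) (s.1 l)) h'⟩
    have : GammaStar.of ι E (d + 1) s =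
        (MvPolynomial.X j : MvPolynomial (Fin (n + 1)) k) • GammaStar.of ι E d t := by
      rw [smul_def', coordAction_X, coordEnd_of]
      congr 1
      apply Subtype.ext
      funext i
      refine Eq.trans ?_ (mul_smul (ratio ι i j) (u i)⁻¹.1 (s.1 i))
      rw [← hu i, Units.mul_inv, one_smul]
    rw [this]
    exact Submodule.smul_mem_smul (Ideal.subset_span ⟨j, rfl⟩) trivial
  | add m m' h h' => exact add_mem (h trivial) (h' trivial)

end Finiteness


/-! ### An annihilating polynomial adapted to the multiplicities -/

section Multiplicity

variable {k : Type u} [Field k] {n : ℕ} {X : Scheme.{u}} {ι : X ⟶ projSpace k n} {E : X.Modules}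

theorem IsVectorBundle.exists_coprime_annihilator [IsIntegral X] [IsClosedImmersion ι]
    (hE : IsVectorBundle E) (f : End E) {r : ℕ} {c : Fin r → k} (hc : Function.Injective c) :
    ∃ q : Polynomial k,
      IsCoprime (∏ i, (Polynomial.X - Polynomial.C (c i)) ^
        moduleMultiplicity ι (gammaStarMap ι f) (c i)) q ∧
      Polynomial.aeval ((gammaStarMap ι f).restrictScalars k)
        ((∏ i, (Polynomial.X - Polynomial.C (c i)) ^
          moduleMultiplicity ι (gammaStarMap ι f) (c i)) * q) = 0 := by
  obtain ⟨j, hj⟩ := exists_mem_chart ι (Classical.arbitrary X)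
  by_cases hall : ∀ x, x ∈ chart ι j
  · have := subsingleton_gammaStar_quotient (E := E) hall
    -- All multiplicities vanish here, so the product is 1, which is coprime to q = 0.
    refine ⟨0, ?_, by rw [mul_zero, map_zero]⟩
    have : ∀ i, moduleMultiplicity ι (gammaStarMap ι f) (c i) = 0 := fun i =>
      Module.finrank_zero_of_subsingleton
    simp [this, isCoprime_one_left]
  · push Not at hall
    obtain ⟨x, hx⟩ := hall
    have := hE.finite_gammaStar ⟨_, hj⟩ hx
    have hfin : Module.Finite k (GammaStar ι E ⧸ irrelevantPart ι E) := finite_gammaStar_quotient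
    have hfin' : Module.Finite k (GammaStar ι E ⧸
      (irrelevantIdeal k n • ⊤ : Submodule (MvPolynomial (Fin (n + 1)) k) (GammaStar ι E))) :=
      finite_gammaStar_quotient
    let ε : MvPolynomial (Fin (n + 1)) k →ₐ[k] k := MvPolynomial.aeval 0
    have hε : (ε : MvPolynomial (Fin (n + 1)) k →+* k) = MvPolynomial.constantCoeff :=
      MvPolynomial.ringHom_ext (fun c => by simp [ε]) fun l => by simp [ε]
    have hchar := aeval_charpoly_mapQ ε (irrelevantIdeal k n)
      (fun s => by rw [mem_irrelevantIdeal, ← hε]; rfl) (gammaStarMap ι f)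
      (fun Q hQ => by rw [hε]; exact aeval_constantCoeff_gammaStarMap f Q hQ)
      (Submodule.smul_top_le_comap_smul_top _ _)
    have hchar' : Polynomial.aeval ((gammaStarMap ι f).restrictScalars k)
      (LinearMap.charpoly (fiberMap ι (gammaStarMap ι f))) = 0 := hchar
    obtain ⟨q, hq, hq'⟩ := exists_eq_prod_mul_coprime hc
      (LinearMap.charpoly_monic (fiberMap ι (gammaStarMap ι f))).ne_zero
    -- The dimension of a generalized eigenspace is the multiplicity of the root in the
    -- characteristic polynomial.
    have hm : ∀ i, moduleMultiplicity ι (gammaStarMap ι f) (c i) =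
      (LinearMap.charpoly (fiberMap ι (gammaStarMap ι f))).rootMultiplicity (c i) := fun i =>
      LinearMap.finrank_maxGenEigenspace_eq _ _
    simp only [hm]
    refine ⟨q, hq', ?_⟩
    rw [← hq]
    exact hchar'

end Multiplicity

/-! ### Local generation of E by twisted sections -/

section LocalGeneration

variable {k : Type u} [Field k] {n : ℕ} {X : Scheme.{u}} {ι : X ⟶ projSpace k n} {E : X.Modules}

/-- Shrink to D(f) inside U ∩ U_j, extend f^N s to U_j and then to a twisted section, and divide by
f^N, a unit on D(f). -/
theorem IsVectorBundle.exists_res_eq_smul [IsIntegral X] [IsAffineHom ι] (hE : IsVectorBundle E)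
    {U : X.Opens} (s : Γ(E, U)) {x : X} (hx : x ∈ U) :
    ∃ (j : Fin (n + 1)) (V : X.Opens) (hU : V ≤ U) (hj : V ≤ chart ι j), x ∈ V ∧
      ∃ (a : Γ(X, V)) (d : ℤ) (t : twistedSections ι E d),
        res E hU s = a • chartRes ι E hj (t.1 j) := by
  obtain ⟨j, hj⟩ := exists_mem_chart ι x
  obtain ⟨f, hf, hxf⟩ := (isAffineOpen_chart ι j).exists_basicOpen_le ⟨x, hx⟩ hj
  obtain ⟨N, hN⟩ := hE.exists_extension (isAffineOpen_chart ι j) f (X.basicOpen_le f) rfl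
    (res E hf s)
  obtain ⟨t', ht'⟩ := hN N le_rfl
  obtain ⟨D, hD⟩ := hE.exists_twistedSections_eq (ι := ι) j t'
  obtain ⟨t, ht⟩ := hD D le_rfl
  obtain ⟨b, hb⟩ := (exists_unit_res f le_rfl).exists_left_inv
  refine ⟨j, X.basicOpen f, hf, X.basicOpen_le f, hxf, b ^ N, D, t, ?_⟩
  have : chartRes ι E (X.basicOpen_le f) (t.1 j) = res E (X.basicOpen_le f) t' := by rw [ht]; rfl
  rw [this, ht', smul_smul, ← mul_pow, hb, one_pow, one_smul]

theorem sectionsMap_res (f : End E) {U V : X.Opens} (h : V ≤ U) (s : Γ(E, U)) :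
    res E h (sectionsMap f U s) = sectionsMap f V (res E h s) :=
  (congr($((Scheme.Modules.Hom.mapPresheaf f).naturality (homOfLE h).op) s)).symm

theorem hom_ext_sectionsMap {f g : End E} (h : ∀ U s, sectionsMap f U s = sectionsMap g U s) :
    f = g := by
  refine Scheme.Modules.hom_ext _ _ fun U => ?_
  ext s
  exact h U s

theorem gammaStarMap_of (f : End E) (d : ℤ) (t : twistedSections ι E d) :
    gammaStarMap ι f (GammaStar.of ι E d t) = GammaStar.of ι E d (twistedMap ι f d t) :=
  gammaStarMapAux_of ι f d t

theorem GammaStar.of_injective (d : ℤ) : Function.Injective (GammaStar.of ι E d) :=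
  DirectSum.of_injective (β := fun d => twistedSections ι E d) d

theorem sectionsMap_chartRes (f : End E) {j : Fin (n + 1)} {V : X.Opens} (h : V ≤ chart ι j) {d : ℤ}
    (t : twistedSections ι E d) :
    sectionsMap f V (chartRes ι E h (t.1 j)) = chartRes ι E h ((twistedMap ι f d t).1 j) :=
  (sectionsMap_res f h _).symm

theorem section_ext_mem {U : X.Opens} {s t : Γ(E, U)}
    (h : ∀ x ∈ U, ∃ (V : X.Opens) (hV : V ≤ U), x ∈ V ∧ res E hV s = res E hV t) : s = t := by
  choose V hV hx h using fun x : U => h x.1 x.2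
  exact section_ext E V hV (fun x hxU => TopologicalSpace.Opens.mem_iSup.2 ⟨⟨x, hxU⟩, hx _⟩) h

theorem sectionsMap_zero (U : X.Opens) (s : Γ(E, U)) : sectionsMap (0 : End E) U s = 0 := rfl

theorem sectionsMap_one (U : X.Opens) (s : Γ(E, U)) : sectionsMap (1 : End E) U s = s := rfl

theorem sectionsMap_add (f g : End E) (U : X.Opens) (s : Γ(E, U)) :
    sectionsMap (f + g) U s = sectionsMap f U s + sectionsMap g U s := rfl

theorem sectionsMap_mul (f g : End E) (U : X.Opens) (s : Γ(E, U)) :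
    sectionsMap (f * g) U s = sectionsMap f U (sectionsMap g U s) := rfl

theorem sectionsMap_scalarEnd (c : Γ(X, ⊤)) (U : X.Opens) (s : Γ(E, U)) :
    sectionsMap (scalarEnd E c) U s = X.presheaf.map (homOfLE (le_top : U ≤ ⊤)).op c • s := rfl

theorem IsVectorBundle.eq_zero_of_gammaStarMap_eq_zero [IsIntegral X] [IsAffineHom ι]
    (hE : IsVectorBundle E) {f : End E} (h : gammaStarMap ι f = 0) : f = 0 := by
  refine hom_ext_sectionsMap fun U s => section_ext_mem fun x hx => ?_
  obtain ⟨j, V, hU, hj, hxV, a, d, t, ht⟩ := hE.exists_res_eq_smul (ι := ι) s hx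
  refine ⟨V, hU, hxV, ?_⟩
  have : twistedMap ι f d t = 0 := GammaStar.of_injective d (by
    rw [← gammaStarMap_of, h, map_zero, LinearMap.zero_apply])
  rw [sectionsMap_res, ht, map_smul, sectionsMap_chartRes, this, sectionsMap_zero, map_zero]
  refine (congrArg _ (map_zero (chartRes ι E hj))).trans (smul_zero a)

/-- The sheaf associated to the image of an idempotent endomorphism of `E` on `Γ_*(E)`. -/
theorem IsVectorBundle.memAssociatedSheaf_iff [IsIntegral X] [IsAffineHom ι]
    (hE : IsVectorBundle E) {e : End E}
    {N : Submodule (MvPolynomial (Fin (n + 1)) k) (GammaStar ι E)}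
    (h1 : ∀ m, gammaStarMap ι e m ∈ N) (h2 : ∀ m ∈ N, gammaStarMap ι e m = m) (U : X.Opens)
    (s : Γ(E, U)) : MemAssociatedSheaf ι N U s ↔ sectionsMap e U s = s := by
  constructor
  · refine fun h => section_ext_mem fun x hx => ?_
    obtain ⟨j, V, hU, hj, hxV, hs⟩ := h x hx
    refine ⟨V, hU, hxV, ?_⟩
    rw [sectionsMap_res]
    refine (Submodule.span_le (p := LinearMap.eqLocus (sectionsMap e V) LinearMap.id)).2 ?_ hs
    rintro _ ⟨d, m, hm, rfl⟩
    have : twistedMap ι e d m = m := GammaStar.of_injective d (by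
      rw [← gammaStarMap_of, h2 _ hm])
    refine (sectionsMap_chartRes e hj m).trans ?_
    rw [this]
    rfl
  · intro hs x hx
    obtain ⟨j, V, hU, hj, hxV, a, d, t, ht⟩ := hE.exists_res_eq_smul (ι := ι) s hx
    refine ⟨j, V, hU, hj, hxV, ?_⟩
    -- As s is fixed by e, in s = a t the section t may be replaced by its image under e, which lies
    -- in N.
    rw [← hs, sectionsMap_res, ht, map_smul, sectionsMap_chartRes]
    refine Submodule.smul_mem _ _ (Submodule.subset_span ⟨d, _, ?_, rfl⟩)
    rw [← gammaStarMap_of]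
    exact h1 _

end LocalGeneration

/-! ### Polynomials in f on E and on Γ_*(E) -/

section Final

variable {k : Type u} [Field k] {n : ℕ} {X : Scheme.{u}} (ι : X ⟶ projSpace k n) {E : X.Modules}

variable (E) in
/-- Multiplication by constants on `E`. -/
def constEnd : k →+* End E where
  toFun c := scalarEnd E (const ι c)
  map_one' := hom_ext_sectionsMap fun U s => by
    rw [sectionsMap_scalarEnd, map_one, map_one, one_smul, sectionsMap_one]
  map_mul' a b := hom_ext_sectionsMap fun U s => by
    rw [sectionsMap_mul, sectionsMap_scalarEnd, sectionsMap_scalarEnd, sectionsMap_scalarEnd,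
      map_mul, map_mul, mul_smul]
  map_zero' := hom_ext_sectionsMap fun U s => by
    rw [sectionsMap_scalarEnd, map_zero, map_zero, zero_smul, sectionsMap_zero]
  map_add' a b := hom_ext_sectionsMap fun U s => by
    rw [sectionsMap_add, sectionsMap_scalarEnd, sectionsMap_scalarEnd, sectionsMap_scalarEnd,
      map_add, map_add, add_smul]

theorem constEnd_commute (f : End E) (c : k) : Commute (constEnd ι E c) f :=
  hom_ext_sectionsMap fun U s => by
    rw [sectionsMap_mul, sectionsMap_mul]
    exact (map_smul (sectionsMap f U) (X.presheaf.map (homOfLE le_top).op (const ι c)) s).symm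

/-- Polynomials in an endomorphism of `E`. -/
def polyEnd (f : End E) : Polynomial k →+* End E :=
  Polynomial.eval₂RingHom' (constEnd ι E) f (constEnd_commute ι f)

theorem polyEnd_X (f : End E) : polyEnd ι f Polynomial.X = f :=
  Polynomial.eval₂_X _ _

theorem polyEnd_C (f : End E) (c : k) :
    polyEnd ι f (Polynomial.C c) = scalarEnd E (const ι c) :=
  Polynomial.eval₂_C _ _

theorem gammaStarMap_ext {φ ψ : Module.End (MvPolynomial (Fin (n + 1)) k) (GammaStar ι E)}
    (h : ∀ d t, φ (GammaStar.of ι E d t) = ψ (GammaStar.of ι E d t)) : φ = ψ := by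
  ext m
  induction m using GammaStar.induction with
  | zero => rw [map_zero, map_zero]
  | of d s => exact h d s
  | add m m' h h' => rw [map_add, map_add, h, h']

variable (E) in
/-- The functor `Γ_*` on endomorphisms. -/
def gammaStarHom : End E →+* Module.End (MvPolynomial (Fin (n + 1)) k) (GammaStar ι E) where
  toFun := gammaStarMap ι
  map_one' := gammaStarMap_ext ι fun d t => gammaStarMap_of _ d t
  map_mul' f g := gammaStarMap_ext ι fun d t => by
    rw [Module.End.mul_apply, gammaStarMap_of, gammaStarMap_of, gammaStarMap_of]
    rfl
  map_zero' := gammaStarMap_ext ι fun d t => by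
    rw [gammaStarMap_of]
    exact map_zero (GammaStar.of ι E d)
  map_add' f g := gammaStarMap_ext ι fun d t => by
    rw [LinearMap.add_apply, gammaStarMap_of, gammaStarMap_of, gammaStarMap_of, ← map_add]
    rfl

theorem gammaStarHom_apply (f : End E) : gammaStarHom ι E f = gammaStarMap ι f := rfl

theorem gammaStarMap_scalarEnd (c : k) (m : GammaStar ι E) :
    gammaStarMap ι (scalarEnd E (const ι c)) m = c • m := by
  induction m using GammaStar.induction with
  | zero => rw [map_zero, smul_zero]
  | of d s =>
    rw [gammaStarMap_of, ← map_smul]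
    rfl
  | add m m' h h' => rw [map_add, h, h', smul_add]

theorem gammaStarMap_polyEnd (f : End E) (p : Polynomial k) (m : GammaStar ι E) :
    gammaStarMap ι (polyEnd ι f p) m =
      Polynomial.aeval ((gammaStarMap ι f).restrictScalars k) p m := by
  rw [← gammaStarHom_apply]
  induction p using Polynomial.induction_on generalizing m with
  | C c =>
    rw [polyEnd_C, Polynomial.aeval_C, Module.algebraMap_end_apply]
    exact gammaStarMap_scalarEnd ι c m
  | add p q hp hq =>
    rw [map_add, map_add, map_add, LinearMap.add_apply, LinearMap.add_apply, hp, hq]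
  | monomial l a h =>
    rw [pow_succ, ← mul_assoc]
    generalize Polynomial.C a * Polynomial.X ^ l = p at h ⊢
    rw [map_mul, map_mul, map_mul, polyEnd_X, Module.End.mul_apply,
      Module.End.mul_apply, h, Polynomial.aeval_X]
    rfl

/-- Since e factors through i and fixes it, a section fixed by e is lifted by l, with no exactness
needed on sections. -/
theorem exists_app_eq_iff {K : X.Modules} {i : K ⟶ E} {e : E ⟶ E} {l : E ⟶ K} (hl : l ≫ i = e)
    (hi : i ≫ e = i) (U : X.Opens) (s : Γ(E, U)) :
    (∃ t : Γ(K, U), i.app U t = s) ↔ sectionsMap (E := E) e U s = s := by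
  constructor
  · rintro ⟨t, rfl⟩
    exact congr(($hi).app U t)
  · intro h
    exact ⟨l.app U s, congr(($hl).app U s).trans h⟩

end Final
end BundleDecomposition
end

theorem mainTheorem10 {k : Type u} [Field k] (n : ℕ) (X : Scheme.{u}) [IsIntegral X]
    (ι : X ⟶ BundleDecomposition.projSpace k n) [IsClosedImmersion ι]
    (E : X.Modules) (hE : BundleDecomposition.IsVectorBundle E) (f : End E)
    (r : ℕ) (eig : Fin r → k) (hdistinct : Function.Injective eig)
    (heig : ∀ i, BundleDecomposition.IsEigenvalue ι f (eig i))
    (φ : Module.End (MvPolynomial (Fin (n + 1)) k) (BundleDecomposition.GammaStar ι E))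
    (hφ : φ = BundleDecomposition.gammaStarMap ι f)
    (μ : Fin r → ℕ) (hμ : ∀ i, μ i = BundleDecomposition.moduleMultiplicity ι φ (eig i))
    (g : Fin r → End E)
    (hg : ∀ i, g i =
      (f - BundleDecomposition.scalarEnd E (BundleDecomposition.const ι (eig i))) ^ μ i)
    (gAll : End E) (hgAll : gAll = (List.ofFn g).prod) :
    -- `E = ker g_1 ⊕ ⋯ ⊕ ker g_r ⊕ im g`
    IsIso (biprod.desc (biproduct.desc fun i => kernel.ι (g i)) (image.ι gAll)) ∧
    -- the decomposition of the graded module `Γ_*(E)`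
    DirectSum.IsInternal (fun o : Option (Fin r) =>
      o.elim (LinearMap.range (BundleDecomposition.gammaStarMap ι gAll))
        (fun i => LinearMap.ker (BundleDecomposition.gammaStarMap ι (g i)))) ∧
    -- the summands of `E` are the sheaves associated to the summands of `Γ_*(E)`
    (∀ i (U : X.Opens) (s : Γ(E, U)),
      (∃ t : Γ(kernel (g i), U), (kernel.ι (g i)).app U t = s) ↔
        BundleDecomposition.MemAssociatedSheaf ι
          (LinearMap.ker (BundleDecomposition.gammaStarMap ι (g i))) U s) ∧
    (∀ (U : X.Opens) (s : Γ(E, U)),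
      (∃ t : Γ(image gAll, U), (image.ι gAll).app U t = s) ↔
        BundleDecomposition.MemAssociatedSheaf ι
          (LinearMap.range (BundleDecomposition.gammaStarMap ι gAll)) U s) := by
  subst hφ
  obtain rfl : μ = fun i => BundleDecomposition.moduleMultiplicity ι
      (BundleDecomposition.gammaStarMap ι f) (eig i) := funext hμ
  obtain ⟨q, hq, hq0⟩ := hE.exists_coprime_annihilator (ι := ι) f hdistinct
  let u : Fin r → Polynomial k := fun i => (Polynomial.X - Polynomial.C (eig i)) ^
    BundleDecomposition.moduleMultiplicity ι (BundleDecomposition.gammaStarMap ι f) (eig i)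
  have hgu : g = fun i => BundleDecomposition.polyEnd ι f (u i) := by
    funext i
    rw [hg, map_pow, map_sub, BundleDecomposition.polyEnd_X, BundleDecomposition.polyEnd_C]
  have hGu : gAll = BundleDecomposition.polyEnd ι f (∏ i, u i) := by
    rw [hgAll, hgu, ← List.prod_ofFn, map_list_prod, List.map_ofFn]
    rfl
  -- The annihilation is known on Γ_*(E) and transfers to E by faithfulness of Γ_*.
  have h0 : BundleDecomposition.polyEnd ι f ((∏ i, u i) * q) = 0 := by
    refine hE.eq_zero_of_gammaStarMap_eq_zero (ι := ι) ?_
    ext m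
    rw [BundleDecomposition.gammaStarMap_polyEnd, hq0]
    rfl
  obtain ⟨p⟩ : Nonempty (BundleDecomposition.SpectralPartition g gAll) := by
    rw [hgu, hGu]
    exact BundleDecomposition.exists_spectralPartition (BundleDecomposition.polyEnd ι f) u q
      (BundleDecomposition.pairwise_isCoprime_pow hdistinct _) hq h0
  -- Pushing forward the partition on E, rather than building another, makes both decompositions use
  -- the same projections.
  let p' := p.map (BundleDecomposition.gammaStarHom ι E)
  refine ⟨p.isIso_desc, p'.isInternal, fun i U s => ?_, fun U s => ?_⟩
  · obtain ⟨l, hl, hi⟩ := p.kernel_fac i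
    rw [BundleDecomposition.exists_app_eq_iff hl hi, hE.memAssociatedSheaf_iff (e := p.e i)]
    · exact fun m => p'.apply_apply_eq_zero i m
    · exact fun m hm => p'.apply_eq_self hm
  · obtain ⟨l, hl, hi⟩ := p.image_fac
    rw [BundleDecomposition.exists_app_eq_iff hl hi, hE.memAssociatedSheaf_iff (e := p.e₀)]
    · intro m
      exact ⟨p'.b m, (LinearMap.congr_fun p'.e₀_eq' m).symm⟩
    · rintro _ ⟨m, rfl⟩
      exact p'.e₀_apply_apply m
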